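/- Let color space be $\mathbb{R}^3$. A gamut $\Gamma$ is a tuple $(K,R,G,B)\in(\mathbb{R}^3)^4=\mathbb{R}^{12}$; its other corners are $C=G+B-K$, $M=R+B-K$, $Y=R+G-K$, $W=R+G+B-2K$, and its set of colors is the (possibly degenerate) parallelepiped $\{K+\alpha(R-K)+\beta(G-K)+\gamma(B-K):\alpha,\beta,\gamma\in[0,1]\}$. For each $c\in\{K,R,G,B,C,M,Y,W\}$ let a quasiconvex function $q_c:\mathbb{R}^3\to\mathbb{R}$ be given, and let $Q_c(\Gamma)$ be the value of $q_c$ at the corner of $\Gamma$ labeled $c$. Let $P_1,\dots,P_n$ ($n\ge 1$) be the gamuts of $n$ projectors. A gamut is feasible if its set of colors is contained in that of every $P_i$. For a nonempty $S\subseteq\{1,\dots,n\}$, let the quasiconvex program of $S$ be the one that asks for the lexicographically least pair $(t,\Gamma)\in\mathbb{R}\times\mathbb{R}^{12}$ such that $Q_c(\Gamma)\le t$ for all eight $c$ and the colors of $\Gamma$ are contained in those of $P_i$ for all $i\in S$, or for the information that there is no such pair. Theorem. The gamut that minimizes $\max_c Q_c(\Gamma)$ among all feasible gamuts can be found in linear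 time by quasiconvex programming. That is, there are a fixed program for a randomized random access machine and constants $k$ and $C$, all independent of $n$, the $q_c$ and the $P_i$, such that the following holds. Suppose that the machine has two unit-time primitives: one that tests whether a given gamut is contained in the gamut of a given projector, and one that solves the quasiconvex program of any given nonempty set $S$ of at most $k$ projectors. (That the second primitive exists means in particular that for each of these constant-size subproblems the least pair exists, unless the subproblem is infeasible.) Then the expected number of steps of the program is at most $Cn$, and its output is always correct: it is the solution $(t,\Gamma)$ of the quasiconvex program of $\{1,\dots,n\}$, so that $\Gamma$ is feasible, minimizes $\max_c Q_c$ among the feasible gamuts, and $t=\max_c Q_c(\Gamma)$; or, if there is no feasible gamut, the output says so. -/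

import Mathlib

/-! ### Quasiconvex programs -/

/-- A nested convex family in `ℝ^d`: a right-continuous increasing family of convex sets. -/
structure NestedConvexFamily (d : ℕ) where
  /-- the set belonging to the value `t` -/
  sets : ℝ → Set (Fin d → ℝ)
  convex : ∀ t, Convex ℝ (sets t)
  mono : ∀ t t', t < t' → sets t ⊆ sets t'
  right : ∀ t, sets t = ⋂ t' : Set.Ioi t, sets t'

/-- The nested convex family of sublevel sets of a quasiconvex function. -/
def NestedConvexFamily.ofFun {d : ℕ} (f : (Fin d → ℝ) → ℝ)
    (hf : QuasiconvexOn ℝ Set.univ f) : NestedConvexFamily d where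
  sets t := {x | f x ≤ t}
  convex t := by simpa using hf t
  mono t t' h x hx := le_trans hx h.le
  right t := by
    ext x
    simp only [Set.mem_ofPred_eq, Set.mem_iInter, Subtype.forall, Set.mem_Ioi]
    exact ⟨fun h t' ht => h.trans ht.le, fun h => le_of_forall_gt_imp_ge_of_dense h⟩

/-- The constant nested convex family of a convex set, which expresses the hard constraint `x ∈ A`. -/
def NestedConvexFamily.ofSet {d : ℕ} (A : Set (Fin d → ℝ)) (hA : Convex ℝ A) :
    NestedConvexFamily d where
  sets _ := A
  convex _ := hA
  mono _ _ _ := subset_rfl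
  right t := by
    have : Nonempty (Set.Ioi t) := ⟨⟨t + 1, by simp⟩⟩
    exact (Set.iInter_const A).symm

/-- The pairs `(t, x)` such that `x` lies in all the sets with parameter `t`, ordered
lexicographically: first by `t`, then by the coordinates of `x`. -/
def feasiblePairs {d : ℕ} {ι : Type} (κ : ι → NestedConvexFamily d) :
    Set (ℝ ×ₗ Lex (Fin d → ℝ)) :=
  {p | ∀ i, ofLex (ofLex p).2 ∈ (κ i).sets (ofLex p).1}

/-- `IsAnswer κ a` : `a` is the correct output for the quasiconvex program `κ`, that is, the
lexicographically least feasible pair `(t, x)`, or `none` if there is no feasible pair. -/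
def IsAnswer {d : ℕ} {ι : Type} (κ : ι → NestedConvexFamily d) :
    Option (ℝ × (Fin d → ℝ)) → Prop
  | some (t, x) => IsLeast (feasiblePairs κ) (toLex (t, toLex x))
  | none => feasiblePairs κ = ∅

/-! ### Colors and gamuts -/

/-- Three-dimensional device-independent color space. -/
abbrev Color : Type := Fin 3 → ℝ

/-- The 12-dimensional space of the additive gamuts, that is, of the tuples `(K, R, G, B)`. -/
abbrev Gamut : Type := Fin 12 → ℝ

/-- The labels of the eight corners: black, red, green, blue, cyan, magenta, yellow, white. -/
inductive Corner : Type
  | K | R | G | B | C | M | Y | W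
  deriving DecidableEq

instance : Fintype Corner where
  elems := {.K, .R, .G, .B, .C, .M, .Y, .W}
  complete c := by cases c <;> decide

namespace Gamut

def black (Γ : Gamut) : Color := ![Γ 0, Γ 1, Γ 2]
def red (Γ : Gamut) : Color := ![Γ 3, Γ 4, Γ 5]
def green (Γ : Gamut) : Color := ![Γ 6, Γ 7, Γ 8]
def blue (Γ : Gamut) : Color := ![Γ 9, Γ 10, Γ 11]

/-- The color at each corner of a gamut. -/
def corner (Γ : Gamut) : Corner → Color
  | .K => Γ.black
  | .R => Γ.red
  | .G => Γ.green
  | .B => Γ.blue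
  | .C => Γ.green + Γ.blue - Γ.black
  | .M => Γ.red + Γ.blue - Γ.black
  | .Y => Γ.red + Γ.green - Γ.black
  | .W => Γ.red + Γ.green + Γ.blue - (2 : ℝ) • Γ.black

end Gamut

/-- The color that the device with gamut `Γ` shows for the signal intensities `a 0, a 1, a 2`. -/
def Gamut.mix (Γ : Gamut) (a : Fin 3 → ℝ) : Color :=
  Γ.black + a 0 • (Γ.red - Γ.black) + a 1 • (Γ.green - Γ.black) + a 2 • (Γ.blue - Γ.black)

/-- The parallelepiped of all colors of a gamut. -/
def Gamut.colors (Γ : Gamut) : Set Color :=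
  Γ.mix '' Set.Icc 0 1

/-- The quality `Q_c` of a gamut at the corner `c`. -/
def cornerQuality (q : Corner → Color → ℝ) (c : Corner) (Γ : Gamut) : ℝ :=
  q c (Γ.corner c)

/-- The objective `max_c Q_c`. -/
noncomputable def gamutQuality (q : Corner → Color → ℝ) (Γ : Gamut) : ℝ :=
  Finset.univ.sup' ⟨Corner.K, Finset.mem_univ _⟩ fun c => cornerQuality q c Γ

theorem Gamut.corner_add_smul (Γ Δ : Gamut) (a b : ℝ) (c : Corner) :
    Gamut.corner (a • Γ + b • Δ) c = a • Γ.corner c + b • Δ.corner c := by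
  cases c <;> ext i <;> fin_cases i <;>
    simp [Gamut.corner, Gamut.black, Gamut.red, Gamut.green, Gamut.blue] <;> ring

theorem Gamut.mix_add_smul (Γ Δ : Gamut) (a b : ℝ) (u : Fin 3 → ℝ) :
    Gamut.mix (a • Γ + b • Δ) u = a • Γ.mix u + b • Δ.mix u := by
  ext i
  fin_cases i <;>
    simp [Gamut.mix, Gamut.black, Gamut.red, Gamut.green, Gamut.blue] <;> ring

theorem cornerQuality_quasiconvex (q : Corner → Color → ℝ) (c : Corner)
    (hq : QuasiconvexOn ℝ Set.univ (q c)) :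
    QuasiconvexOn ℝ Set.univ (cornerQuality q c) := by
  intro r x hx y hy a b ha hb hab
  refine ⟨trivial, ?_⟩
  have h := (hq r ⟨trivial, hx.2⟩ ⟨trivial, hy.2⟩ ha hb hab).2
  simpa only [cornerQuality, Gamut.corner_add_smul] using h

theorem Gamut.colors_convex (Γ : Gamut) : Convex ℝ Γ.colors := by
  rintro _ ⟨u, hu, rfl⟩ _ ⟨v, hv, rfl⟩ a b ha hb hab
  refine ⟨a • u + b • v, convex_Icc (0 : Fin 3 → ℝ) 1 hu hv ha hb hab, ?_⟩
  obtain rfl : b = 1 - a := by linarith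
  ext i
  simp [Gamut.mix]
  ring

theorem containment_convex (Δ : Gamut) :
    Convex ℝ {Γ : Gamut | Gamut.colors Γ ⊆ Δ.colors} := by
  intro Γ hΓ Γ' hΓ' a b ha hb hab
  rintro _ ⟨u, hu, rfl⟩
  rw [Gamut.mix_add_smul]
  exact Δ.colors_convex (hΓ ⟨u, hu, rfl⟩) (hΓ' ⟨u, hu, rfl⟩) ha hb hab

/-- The quasiconvex program for the projectors with labels in `S`: one family for each of the
eight corner qualities, and one for each `i ∈ S`, which demands that the gamut be contained in
that of the projector `i`. -/
def gamutProgram (q : Corner → Color → ℝ) (hq : ∀ c, QuasiconvexOn ℝ Set.univ (q c))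
    {n : ℕ} (P : Fin n → Gamut) (S : Finset (Fin n)) :
    Corner ⊕ S → NestedConvexFamily 12
  | .inl c => .ofFun (cornerQuality q c) (cornerQuality_quasiconvex q c (hq c))
  | .inr i => .ofSet {Γ : Gamut | Gamut.colors Γ ⊆ (P i).colors} (containment_convex (P i))

/-! ### Randomized random access programs with primitives -/

/-- Programs of a randomized random access machine. There are number registers, an indirectly
addressed memory of numbers, and solution registers; registers are named by numbers. The
projectors of the input can be accessed only through the primitives `test` and `solve`, by their
indices. A single `solve` is applied to a list of registers that is written out in the program
text, so it concerns a number of projectors that does not depend on the input. -/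
inductive Prog : Type
  | skip
  /-- `x := m` -/
  | const (x m : ℕ)
  /-- `x := y + z` -/
  | add (x y z : ℕ)
  /-- `x := y - z`, truncated at `0` -/
  | sub (x y z : ℕ)
  /-- `x := mem[y]` -/
  | load (x y : ℕ)
  /-- `mem[x] := y` -/
  | store (x y : ℕ)
  /-- `x :=` a uniformly random element of `{0, …, y}` -/
  | rand (x y : ℕ)
  /-- evaluation primitive: `x := 1` if the gamut in the solution register `r` is contained in
  the gamut of the projector whose index is in `y`, and otherwise `x := 0` -/
  | test (x y r : ℕ)
  /-- subproblem primitive: solution register `r :=` the solution of the subproblem of the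
  projectors whose indices are in the registers `ys` -/
  | solve (r : ℕ) (ys : List ℕ)
  /-- solution register `r :=` solution register `r'` -/
  | copy (r r' : ℕ)
  | seq (p p' : Prog)
  /-- `if x < y then p else p'` -/
  | ifLt (x y : ℕ) (p p' : Prog)
  /-- `while x < y do p` -/
  | whileLt (x y : ℕ) (p : Prog)

/-- The contents of the machine. A solution register holds a value and a gamut, or `none`. -/
structure Store where
  reg : ℕ → ℕ
  mem : ℕ → ℕ
  sol : ℕ → Option (ℝ × Gamut)

/-- `x := v` -/
def Store.setReg (s : Store) (x v : ℕ) : Store :=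
  { s with reg := Function.update s.reg x v }

/-- `mem[a] := v` -/
def Store.setMem (s : Store) (a v : ℕ) : Store :=
  { s with mem := Function.update s.mem a v }

/-- solution register `r := v` -/
def Store.setSol (s : Store) (r : ℕ) (v : Option (ℝ × Gamut)) : Store :=
  { s with sol := Function.update s.sol r v }

/-- A configuration: the list of the programs still to be run, and the store. The machine has
halted when the list is empty. -/
abbrev Config : Type := List Prog × Store

/-- Whether the gamut in a solution register passes the constraint of the projector number `i`. -/
def PassesTest {n : ℕ} (P : Fin n → Gamut) (i : ℕ) (a : Option (ℝ × Gamut)) : Prop :=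
  ∃ h : i < n, ∃ p ∈ a, Gamut.colors p.2 ⊆ (P ⟨i, h⟩).colors

open Classical in
/-- One step of the machine, as a probability distribution on the next configuration. -/
noncomputable def step {n : ℕ} (P : Fin n → Gamut)
    (solver : Finset (Fin n) → Option (ℝ × Gamut)) : Config → PMF Config
  | ([], s) => PMF.pure ([], s)
  | (.skip :: k, s) => PMF.pure (k, s)
  | (.const x m :: k, s) => PMF.pure (k, s.setReg x m)
  | (.add x y z :: k, s) => PMF.pure (k, s.setReg x (s.reg y + s.reg z))
  | (.sub x y z :: k, s) => PMF.pure (k, s.setReg x (s.reg y - s.reg z))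
  | (.load x y :: k, s) => PMF.pure (k, s.setReg x (s.mem (s.reg y)))
  | (.store x y :: k, s) => PMF.pure (k, s.setMem (s.reg x) (s.reg y))
  | (.rand x y :: k, s) =>
      (PMF.uniformOfFintype (Fin (s.reg y + 1))).map fun v => (k, s.setReg x v)
  | (.test x y r :: k, s) =>
      PMF.pure (k, s.setReg x (if PassesTest P (s.reg y) (s.sol r) then 1 else 0))
  | (.solve r ys :: k, s) =>
      PMF.pure (k, s.setSol r (solver {i | (i : ℕ) ∈ ys.map s.reg}))
  | (.copy r r' :: k, s) => PMF.pure (k, s.setSol r (s.sol r'))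
  | (.seq p p' :: k, s) => PMF.pure (p :: p' :: k, s)
  | (.ifLt x y p p' :: k, s) =>
      PMF.pure (if s.reg x < s.reg y then (p :: k, s) else (p' :: k, s))
  | (.whileLt x y p :: k, s) =>
      PMF.pure (if s.reg x < s.reg y then (p :: .whileLt x y p :: k, s) else (k, s))

/-- The initial configuration: register `0` holds the number `n` of projectors. -/
def initial (prog : Prog) (n : ℕ) : Config :=
  ([prog], { reg := Function.update (fun _ => 0) 0 n, mem := fun _ => 0, sol := fun _ => none })

/-- The distribution of the configuration after `m` steps. -/
noncomputable def configAfter {n : ℕ} (P : Fin n → Gamut)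
    (solver : Finset (Fin n) → Option (ℝ × Gamut)) (prog : Prog) : ℕ → PMF Config
  | 0 => PMF.pure (initial prog n)
  | m + 1 => (configAfter P solver prog m).bind (step P solver)

/-- The expected number of steps until the machine halts, as the sum over `m` of the
probability that it has not halted after `m` steps. Every operation, primitives included,
is one step. -/
noncomputable def expectedTime {n : ℕ} (P : Fin n → Gamut)
    (solver : Finset (Fin n) → Option (ℝ × Gamut)) (prog : Prog) : ENNReal :=
  ∑' m : ℕ, (configAfter P solver prog m).toOuterMeasure {cfg | cfg.1 ≠ []}

/-! The program is of LP type with a combinatorial dimension that does not depend on `n`, and a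
nested form of Clarkson's sampling algorithm solves it.

Dimension: the containment constraints, the sublevel sets of the corner qualities and the
lexicographic initial segments are convex in `ℝ^12`. Helly's theorem, with 13 sets at a time, is
used twice: at most 13 projectors force the optimal value, and at most 13 more force the
lexicographically least gamut at that value. So every nonempty set of projectors has a basis of size
at most 26 (`exists_basis`). The argument also yields least pairs for large sets, although they are
assumed only for small ones.

Sampling: draw `r` elements with replacement from a list of length `m ≤ r * r` and solve them
together with a set `G` of kept elements. Among `r + 1` draws at most 26 violate the answer for `G`
and the other draws, so on average at most `26 * m / (r + 1)` positions of the list violate the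
answer (`sum_violations_le`). By Markov's inequality, at most `64 * r` do with probability at least
one half, and these are then added to `G`. If there is any violator, a new element of a fixed basis
of the list is among them, so this happens at most 26 times; when there is none, the answer is
final. A problem of size `m` thus costs a constant expected number of problems of size `O(√m)` and
`O(m)` further steps (`mainLoop_clarkson`).

Programs cannot recurse, so the nesting has fixed depth. At the bottom, samples of size 26 are drawn
until one has no violators (`mainLoop_reject`), at a cost of `O(L ^ 32)`. One level of Clarkson's
algorithm turns `O(L ^ (2 * e))` into `O(L ^ e)`, so five levels give linear time.

The machine is analysed through `wp`, which bounds the expected running time plus the expectation of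
a function of the final store. If that function is `0` at correct stores and `∞` at the others, one
finite bound gives both the running time and correctness. -/

open scoped ENNReal

/-! ### Expected cost of programs and its relation to the machine -/

/-- The expected number of steps of a program plus the expectation of `f` at its final store. For a
loop, it is the least function that satisfies the recursion. -/
noncomputable def wp {n : ℕ} (P : Fin n → Gamut) (solver : Finset (Fin n) → Option (ℝ × Gamut)) :
    Prog → (Store → ℝ≥0∞) → Store → ℝ≥0∞
  | .rand x y, f, s => 1 + (∑ v : Fin (s.reg y + 1), f (s.setReg x v)) / ((s.reg y + 1 : ℕ) : ℝ≥0∞)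
  | .skip, f, s => 1 + f s
  | .const x m, f, s => 1 + f (s.setReg x m)
  | .add x y z, f, s => 1 + f (s.setReg x (s.reg y + s.reg z))
  | .sub x y z, f, s => 1 + f (s.setReg x (s.reg y - s.reg z))
  | .load x y, f, s => 1 + f (s.setReg x (s.mem (s.reg y)))
  | .store x y, f, s => 1 + f (s.setMem (s.reg x) (s.reg y))
  | .test x y r, f, s => 1 + f (s.setReg x
      (open Classical in if PassesTest P (s.reg y) (s.sol r) then 1 else 0))
  | .solve r ys, f, s => 1 + f (s.setSol r (solver {i | (i : ℕ) ∈ ys.map s.reg}))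
  | .copy r r', f, s => 1 + f (s.setSol r (s.sol r'))
  | .seq p p', f, s => 1 + wp P solver p (wp P solver p' f) s
  | .ifLt x y p p', f, s =>
      1 + if s.reg x < s.reg y then wp P solver p f s else wp P solver p' f s
  | .whileLt x y p, f, s =>
      sInf {g : Store → ℝ≥0∞ | ∀ s, 1 + (if s.reg x < s.reg y then wp P solver p g s else f s) ≤ g s} s

section

variable {n : ℕ} {P : Fin n → Gamut} {solver : Finset (Fin n) → Option (ℝ × Gamut)}

theorem wp_mono (p : Prog) {f g : Store → ℝ≥0∞} (h : f ≤ g) : wp P solver p f ≤ wp P solver p g := by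
  induction p generalizing f g with
  | seq p p' ih ih' => intro s; simp only [wp]; gcongr; exact ih (ih' h) s
  | ifLt x y p p' ih ih' =>
    intro s; simp only [wp]; gcongr; split_ifs
    · exact ih h s
    · exact ih' h s
  | whileLt x y p ih =>
    intro s
    simp only [wp]
    refine sInf_le_sInf (α := Store → ℝ≥0∞) ?_ s
    rintro X hX
    refine fun s => le_trans ?_ (hX s)
    gcongr
    split_ifs
    · exact le_rfl
    · exact h s
  | rand x y =>
    intro s; simp only [wp]; gcongr; exact h _
  | _ => intro s; simp only [wp]; gcongr; exact h _

/-- One half of the Knaster–Tarski argument: by monotonicity of the body, an infimum of prefixed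
points is again prefixed. -/
theorem wp_while_ge (x y : ℕ) (p : Prog) (f : Store → ℝ≥0∞) (s : Store) :
    1 + (if s.reg x < s.reg y then wp P solver p (wp P solver (.whileLt x y p) f) s else f s) ≤
      wp P solver (.whileLt x y p) f s := by
  conv_rhs => simp only [wp]
  rw [sInf_apply]
  refine le_iInf ?_
  rintro ⟨X, hX⟩
  refine le_trans ?_ (hX s)
  gcongr
  split_ifs
  · refine wp_mono p ?_ s
    intro s'
    simp only [wp]
    exact sInf_le (α := Store → ℝ≥0∞) hX s'
  · exact le_rfl

theorem wp_while_le_of {x y : ℕ} {p : Prog} {f g : Store → ℝ≥0∞}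
    (h : ∀ s, 1 + (if s.reg x < s.reg y then wp P solver p g s else f s) ≤ g s) :
    wp P solver (.whileLt x y p) f ≤ g := by
  intro s
  simp only [wp]
  exact sInf_le (α := Store → ℝ≥0∞) (a := g) (by exact h) s

/-- The other half: unfolding the least prefixed point once gives a prefixed point. -/
theorem wp_while_le (x y : ℕ) (p : Prog) (f : Store → ℝ≥0∞) (s : Store) :
    wp P solver (.whileLt x y p) f s ≤
    1 + (if s.reg x < s.reg y then wp P solver p (wp P solver (.whileLt x y p) f) s else f s) := by
  refine wp_while_le_of (g := fun s => 1 + (if s.reg x < s.reg y then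
    wp P solver p (wp P solver (.whileLt x y p) f) s else f s)) ?_ s
  intro s
  gcongr
  split_ifs
  · refine wp_mono p ?_ s
    intro s'
    exact wp_while_ge x y p f s'
  · exact le_rfl

/-- The expected remaining cost of a configuration. -/
noncomputable def stackCost (P : Fin n → Gamut) (solver : Finset (Fin n) → Option (ℝ × Gamut))
    (g : Store → ℝ≥0∞) : List Prog → Store → ℝ≥0∞
  | [] => g
  | p :: k => wp P solver p (stackCost P solver g k)

theorem tsum_pure_mul {α : Type*} (a : α) (Φ : α → ℝ≥0∞) : ∑' c, PMF.pure a c * Φ c = Φ a := by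
  classical
  rw [tsum_eq_single a]
  · simp
  · intro b hb; simp [hb]

theorem tsum_bind_mul {α β : Type*} (p : PMF α) (f : α → PMF β) (Φ : β → ℝ≥0∞) :
    ∑' b, p.bind f b * Φ b = ∑' a, p a * ∑' b, f a b * Φ b := by
  simp only [PMF.bind_apply, ← ENNReal.tsum_mul_right, ← ENNReal.tsum_mul_left]
  rw [ENNReal.tsum_comm]
  simp only [mul_assoc]

/-- Each step pays one unit out of the potential `stackCost`, in expectation. Only this inequality
is needed for upper bounds. -/
theorem stackCost_step (g : Store → ℝ≥0∞) (p : Prog) (k : List Prog) (s : Store) :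
    1 + ∑' c, step P solver (p :: k, s) c * stackCost P solver g c.1 c.2 ≤
      stackCost P solver g (p :: k) s := by
  cases p with
  | whileLt x y p =>
    refine le_trans ?_ (wp_while_ge x y p _ s)
    simp only [step, tsum_pure_mul]
    gcongr
    split_ifs <;> simp [stackCost]
  | ifLt x y p p' =>
    simp only [step, tsum_pure_mul, stackCost, wp]
    gcongr
    split_ifs <;> simp [stackCost]
  | rand x y =>
    simp only [step, stackCost, wp, PMF.map, tsum_bind_mul, Function.comp_apply, tsum_pure_mul]
    refine le_of_eq ?_
    congr 1
    refine (tsum_bind_mul (PMF.uniformOfFintype (Fin (s.reg y + 1))) (fun v => PMF.pure (v : ℕ))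
      (fun v => stackCost P solver g k (s.setReg x v))).trans ?_
    simp only [tsum_pure_mul, tsum_fintype, PMF.uniformOfFintype_apply, Fintype.card_fin,
      ← Finset.mul_sum]
    rw [ENNReal.div_eq_inv_mul]
  | _ => simp only [step, tsum_pure_mul, stackCost, wp]; rfl

/-- The one-step inequality telescopes. A halted configuration pays nothing and keeps its potential
`g`. -/
theorem configAfter_cost (g : Store → ℝ≥0∞) (prog : Prog) (m : ℕ) :
    ∑ j ∈ Finset.range m, (configAfter P solver prog j).toOuterMeasure {cfg | cfg.1 ≠ []} +
      ∑' c, configAfter P solver prog m c * stackCost P solver g c.1 c.2 ≤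
    wp P solver prog g (initial prog n).2 := by
  induction m with
  | zero => simp [configAfter, initial, stackCost]
  | succ m ih =>
    refine le_trans ?_ ih
    rw [Finset.sum_range_succ, add_assoc]
    gcongr
    rw [configAfter, tsum_bind_mul, PMF.toOuterMeasure_apply, ← ENNReal.tsum_add]
    refine ENNReal.tsum_le_tsum ?_
    rintro ⟨k, s⟩
    cases k with
    | nil => simp [step]
    | cons p k =>
      rw [Set.indicator_of_mem (by simp)]
      calc _ = configAfter P solver prog m (p :: k, s) * (1 + ∑' c, step P solver (p :: k, s) c *
              stackCost P solver g c.1 c.2) := by rw [mul_add, mul_one]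
        _ ≤ _ := by gcongr; exact stackCost_step g p k s

theorem expectedTime_le_wp (g : Store → ℝ≥0∞) (prog : Prog) :
    expectedTime P solver prog ≤ wp P solver prog g (initial prog n).2 := by
  unfold expectedTime
  rw [ENNReal.tsum_eq_iSup_nat]
  exact iSup_le fun m => le_self_add.trans (configAfter_cost g prog m)

/-- A final store reached with positive probability where `g` is `∞` would contribute `∞` to the
expected potential. -/
theorem ne_top_of_wp_ne_top {g : Store → ℝ≥0∞} {prog : Prog}
    (h : wp P solver prog g (initial prog n).2 ≠ ∞) {m : ℕ} {s : Store}
    (hs : ([], s) ∈ (configAfter P solver prog m).support) : g s ≠ ∞ := by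
  intro hg
  refine h (top_le_iff.1 (le_trans ?_ (le_add_self.trans (configAfter_cost g prog m))))
  refine le_trans ?_ (ENNReal.le_tsum (([], s) : Config))
  simp only [stackCost, hg]
  rw [ENNReal.mul_top ((PMF.mem_support_iff _ _).1 hs)]

end

/-! ### The combinatorial dimension of the gamut program -/

/-- An exact answer function for the subproblems of `P`: it agrees with `solver` on small sets,
and has combinatorial dimension at most 26. -/
structure LPOracle {n : ℕ} (P : Fin n → Gamut) (solver ans : Finset (Fin n) → Option (ℝ × Gamut)) :
    Prop where
  solver_eq : ∀ S, S.Nonempty → S.card ≤ 26 → solver S = ans S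
  basis : ∀ S, S.Nonempty → ∃ B ⊆ S, B.Nonempty ∧ B.card ≤ 26 ∧ ans B = ans S
  none_mono : ∀ S T, S.Nonempty → S ⊆ T → ans S = none → ans T = none
  passes : ∀ S, S.Nonempty → ans S ≠ none → ∀ i : Fin n, i ∈ S → PassesTest P i (ans S)
  ext : ∀ S T, S.Nonempty → S ⊆ T → (∀ i : Fin n, i ∈ T → PassesTest P i (ans S)) → ans T = ans S

theorem isAnswer_unique {d : ℕ} {ι : Type} {κ : ι → NestedConvexFamily d}
    {a b : Option (ℝ × (Fin d → ℝ))} (ha : IsAnswer κ a) (hb : IsAnswer κ b) : a = b := by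
  rcases a with _ | ⟨t, x⟩ <;> rcases b with _ | ⟨t', x'⟩
  · rfl
  · have := hb.1
    simp only [IsAnswer] at ha
    rw [ha] at this
    exact this.elim
  · have := ha.1
    simp only [IsAnswer] at hb
    rw [hb] at this
    exact this.elim
  · have h := IsLeast.unique ha hb
    have h1 : (t, toLex x) = (t', toLex x') := h
    simp only [Prod.mk.injEq] at h1
    obtain ⟨rfl, h2⟩ := h1
    have h3 : x = x' := h2
    rw [h3]

/-- A proper convex combination of two points first differs from the larger one at the coordinate
where the two points first differ, and is smaller there. -/
theorem convex_lex_Iic {d : ℕ} (z : Lex (Fin d → ℝ)) : Convex ℝ {x : Fin d → ℝ | toLex x ≤ z} := by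
  have key : ∀ x y : Fin d → ℝ, toLex x ≤ toLex y → ∀ a b : ℝ, 0 ≤ a → 0 ≤ b → a + b = 1 →
      toLex (a • x + b • y) ≤ toLex y := by
    intro x y hxy a b ha hb hab
    obtain rfl : b = 1 - a := by linarith
    rcases eq_or_lt_of_le hxy with h | h
    · have : x = y := h
      subst this
      refine le_of_eq (congrArg toLex ?_)
      rw [← add_smul, hab, one_smul]
    · rcases eq_or_lt_of_le ha with rfl | ha
      · simp
      · obtain ⟨i, hi, hlt⟩ := h
        refine le_of_lt ⟨i, fun j hj => ?_, ?_⟩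
        · have := hi j hj
          simp only [Pi.toLex_apply] at this ⊢
          simp [this]
          ring
        · have : x i < y i := hlt
          simp only [Pi.toLex_apply, Pi.add_apply, Pi.smul_apply, smul_eq_mul]
          nlinarith
  intro x hx y hy a b ha hb hab
  rcases le_total (toLex x) (toLex y) with h | h
  · exact (key x y h a b ha hb hab).trans hy
  · have := (key y x h b a hb ha (by linarith)).trans hx
    rwa [add_comm] at this

section

variable {q : Corner → Color → ℝ} (hq : ∀ c, QuasiconvexOn ℝ Set.univ (q c)) {n : ℕ}
  (P : Fin n → Gamut)

theorem mem_feasiblePairs_gamutProgram {S : Finset (Fin n)} {t : ℝ} {Γ : Gamut} :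
    toLex (t, toLex Γ) ∈ feasiblePairs (gamutProgram q hq P S) ↔
      (∀ c, cornerQuality q c Γ ≤ t) ∧ ∀ i ∈ S, Γ.colors ⊆ (P i).colors := by
  simp only [feasiblePairs, Set.mem_ofPred_eq, Sum.forall]
  refine and_congr Iff.rfl ?_
  simp only [Subtype.forall]
  rfl

theorem isAnswer_some_iff {S : Finset (Fin n)} {t : ℝ} {Γ : Gamut} :
    IsAnswer (gamutProgram q hq P S) (some (t, Γ)) ↔
      ((∀ c, cornerQuality q c Γ ≤ t) ∧ ∀ i ∈ S, Γ.colors ⊆ (P i).colors) ∧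
      ∀ t' Γ', (∀ c, cornerQuality q c Γ' ≤ t') → (∀ i ∈ S, Γ'.colors ⊆ (P i).colors) →
        t < t' ∨ t = t' ∧ toLex Γ ≤ toLex Γ' := by
  rw [← mem_feasiblePairs_gamutProgram hq P]
  refine and_congr Iff.rfl ⟨fun h t' Γ' h1 h2 => ?_, fun h => ?_⟩
  · have := h ((mem_feasiblePairs_gamutProgram hq P).2 ⟨h1, h2⟩)
    rw [Prod.Lex.le_iff] at this
    exact this
  · intro p hp
    have hp' : toLex ((ofLex p).1, toLex (ofLex (ofLex p).2)) ∈
      feasiblePairs (gamutProgram q hq P S) := hp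
    rw [mem_feasiblePairs_gamutProgram] at hp'
    rw [Prod.Lex.le_iff]
    exact h _ _ hp'.1 hp'.2

/-- The qualities never cause infeasibility, because `t` may be taken as large as `gamutQuality q
Γ`. -/
theorem isAnswer_none_iff {S : Finset (Fin n)} :
    IsAnswer (gamutProgram q hq P S) none ↔ ∀ Γ : Gamut, ¬ ∀ i ∈ S, Γ.colors ⊆ (P i).colors := by
  refine ⟨fun h Γ hΓ => ?_, fun h => ?_⟩
  · have h0 : feasiblePairs (gamutProgram q hq P S) = ∅ := h
    have : toLex (gamutQuality q Γ, toLex Γ) ∈ feasiblePairs (gamutProgram q hq P S) :=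
      (mem_feasiblePairs_gamutProgram hq P).2
        ⟨fun c => Finset.le_sup' (fun c => cornerQuality q c Γ) (Finset.mem_univ c), hΓ⟩
    rw [h0] at this
    exact this
  · change feasiblePairs (gamutProgram q hq P S) = ∅
    refine Set.eq_empty_iff_forall_notMem.2 fun p hp => ?_
    have hp' : toLex ((ofLex p).1, toLex (ofLex (ofLex p).2)) ∈
      feasiblePairs (gamutProgram q hq P S) := hp
    rw [mem_feasiblePairs_gamutProgram] at hp'
    exact h _ hp'.2

/-- Helly's theorem for the containment constraints together with a convex condition. -/
theorem helly_containment {A : Set Gamut} (hA : Convex ℝ A) (hne : A.Nonempty) (S : Finset (Fin n))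
    (h : ∀ I ⊆ S, I.Nonempty → I.card ≤ 13 → ∃ Γ ∈ A, ∀ i ∈ I, Γ.colors ⊆ (P i).colors) :
    ∃ Γ ∈ A, ∀ i ∈ S, Γ.colors ⊆ (P i).colors := by
  rcases S.eq_empty_or_nonempty with rfl | hS
  · obtain ⟨Γ, hΓ⟩ := hne
    exact ⟨Γ, hΓ, by simp⟩
  -- Intersecting each constraint with `A`, instead of adding `A` as one more set, keeps the Helly
  -- number at 12 + 1.
  have := Convex.helly_theorem' (𝕜 := ℝ) (s := S)
    (F := fun i => A ∩ {Γ : Gamut | Γ.colors ⊆ (P i).colors})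
    (fun i _ => hA.inter (containment_convex (P i))) (fun I hI hc => by
      rcases I.eq_empty_or_nonempty with rfl | hI0
      · simp
      · obtain ⟨Γ, h1, h2⟩ := h I hI hI0 (by simpa using hc)
        exact ⟨Γ, by simpa using fun i hi => ⟨h1, h2 i hi⟩⟩)
  obtain ⟨Γ, hΓ⟩ := this
  simp only [Set.mem_iInter, Set.mem_inter_iff, Set.mem_ofPred_eq] at hΓ
  obtain ⟨i, hi⟩ := hS
  exact ⟨Γ, (hΓ i hi).1, fun i hi => (hΓ i hi).2⟩

variable {P} {solver : Finset (Fin n) → Option (ℝ × Gamut)}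

/-- An infeasible small subset is itself a basis. Otherwise `B₁` maximizes the value among subsets
of size at most 13, and `B₂` maximizes the gamut lexicographically among the sets between `B₁` and
`S` of size at most 26. Helly's theorem shows that neither maximum is exceeded by `S`. -/
theorem exists_basis (hs : ∀ S : Finset (Fin n), S.Nonempty → S.card ≤ 26 →
      IsAnswer (gamutProgram q hq P S) (solver S)) (S : Finset (Fin n)) (hS : S.Nonempty) :
    ∃ B ⊆ S, B.Nonempty ∧ B.card ≤ 26 ∧ IsAnswer (gamutProgram q hq P S) (solver B) := by
  classical
  by_cases hn : ∃ B ⊆ S, B.Nonempty ∧ B.card ≤ 26 ∧ solver B = none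
  · obtain ⟨B, hB, h0, hc, h⟩ := hn
    refine ⟨B, hB, h0, hc, ?_⟩
    have h1 := hs B h0 hc
    rw [h, isAnswer_none_iff] at h1 ⊢
    exact fun Γ hΓ => h1 Γ fun i hi => hΓ i (hB hi)
  push Not at hn
  have hex : ∀ B : Finset (Fin n), ∃ tx : ℝ × Gamut, B ⊆ S → B.Nonempty → B.card ≤ 26 →
      solver B = some tx := by
    intro B
    by_cases h : B ⊆ S ∧ B.Nonempty ∧ B.card ≤ 26
    · obtain ⟨tx, h'⟩ := Option.ne_none_iff_exists'.1 (hn B h.1 h.2.1 h.2.2)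
      exact ⟨tx, fun _ _ _ => h'⟩
    · exact ⟨(0, 0), fun h1 h2 h3 => (h ⟨h1, h2, h3⟩).elim⟩
  choose v hv using hex
  have hA : ∀ B ⊆ S, B.Nonempty → B.card ≤ 26 →
      IsAnswer (gamutProgram q hq P B) (some ((v B).1, (v B).2)) := fun B h1 h2 h3 => by
    have := hs B h2 h3
    rwa [hv B h1 h2 h3] at this
  simp only [isAnswer_some_iff] at hA
  obtain ⟨i₀, hi₀⟩ := hS
  -- the largest value of a subproblem of size at most 13
  obtain ⟨B₁, hB₁, hmax₁⟩ := Finset.exists_max_image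
    (S.powerset.filter fun B => B.Nonempty ∧ B.card ≤ 13) (fun B => (v B).1)
    ⟨{i₀}, by simp [hi₀]⟩
  simp only [Finset.mem_filter, Finset.mem_powerset] at hB₁ hmax₁
  obtain ⟨hB₁S, hB₁n, hB₁c⟩ := hB₁
  have hQ : ∀ t, Convex ℝ {Γ : Gamut | ∀ c, cornerQuality q c Γ ≤ t} := by
    intro t
    rw [Set.ofPred_forall]
    exact convex_iInter fun c => by simpa using cornerQuality_quasiconvex q c (hq c) t
  -- By the choice of `B₁`, any 13 constraints can be met with value at most that of `B₁`, hence so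
  -- can all of them.
  have ht : ∀ T ⊆ S, ∃ Γ, (∀ c, cornerQuality q c Γ ≤ (v B₁).1) ∧
      ∀ i ∈ T, Γ.colors ⊆ (P i).colors := by
    intro T hT
    refine helly_containment P (hQ (v B₁).1)
      ⟨_, (hA B₁ hB₁S hB₁n (by omega)).1.1⟩ T fun I hI hIn hIc => ?_
    have := (hA I (hI.trans hT) hIn (by omega)).1
    exact ⟨_, fun c => (this.1 c).trans (hmax₁ I ⟨hI.trans hT, hIn, hIc⟩), this.2⟩
  have hteq : ∀ B ⊆ S, B₁ ⊆ B → B.card ≤ 26 → (v B).1 = (v B₁).1 := by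
    intro B hB hBB hc
    have hBn := hB₁n.mono hBB
    obtain ⟨Γ, h1, h2⟩ := ht B hB
    have ha := hA B hB hBn hc
    have hb := hA B₁ hB₁S hB₁n (by omega)
    have h3 := ha.2 _ Γ h1 h2
    have h4 := hb.2 _ _ ha.1.1 fun i hi => ha.1.2 i (hBB hi)
    rcases h3 with h3 | h3 <;> rcases h4 with h4 | h4 <;> linarith [h3, h4]
  obtain ⟨B₂, hB₂, hmax₂⟩ := Finset.exists_max_image
    (S.powerset.filter fun B => B₁ ⊆ B ∧ B.card ≤ 26) (fun B => toLex (v B).2)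
    ⟨B₁, by simp [hB₁S]; omega⟩
  simp only [Finset.mem_filter, Finset.mem_powerset] at hB₂ hmax₂
  obtain ⟨hB₂S, hB₂B, hB₂c⟩ := hB₂
  have hB₂n := hB₁n.mono hB₂B
  refine ⟨B₂, hB₂S, hB₂n, hB₂c, ?_⟩
  have ha := hA B₂ hB₂S hB₂n hB₂c
  have htB := hteq B₂ hB₂S hB₂B hB₂c
  -- For `I` of size at most 13, `I ∪ B₁` competes with `B₂` because 13 + 13 = 26, so its least
  -- gamut lies in the convex set of gamuts of optimal value up to that of `B₂`. The common point
  -- found must be the gamut of `B₂`, which is the least for `B₂`.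
  obtain ⟨Γ, ⟨hΓ1, hΓ2⟩, hΓ3⟩ := helly_containment P
    ((hQ (v B₁).1).inter (convex_lex_Iic (toLex (v B₂).2)))
    ⟨(v B₂).2, fun c => htB ▸ ha.1.1 c, le_refl (toLex (v B₂).2)⟩ S fun I hI hIn hIc => by
      have hsub : I ∪ B₁ ⊆ S := Finset.union_subset hI hB₁S
      have hcard : (I ∪ B₁).card ≤ 26 := (Finset.card_union_le _ _).trans (by omega)
      have h1 := hA (I ∪ B₁) hsub (hIn.mono Finset.subset_union_left) hcard
      refine ⟨(v (I ∪ B₁)).2, ⟨fun c => ?_, ?_⟩, fun i hi => h1.1.2 i (Finset.mem_union_left _ hi)⟩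
      · rw [← hteq _ hsub Finset.subset_union_right hcard]
        exact h1.1.1 c
      · exact hmax₂ _ ⟨hsub, Finset.subset_union_right, hcard⟩
  have hΓeq : Γ = (v B₂).2 := by
    have h1 := ha.2 _ Γ hΓ1 fun i hi => hΓ3 i (hB₂S hi)
    rw [htB] at h1
    rcases h1 with h1 | h1
    · exact (lt_irrefl _ h1).elim
    · exact le_antisymm (α := Lex (Fin 12 → ℝ)) hΓ2 h1.2
  rw [hv B₂ hB₂S hB₂n hB₂c]
  refine (isAnswer_some_iff hq P (t := (v B₂).1) (Γ := (v B₂).2)).2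
    ⟨⟨ha.1.1, hΓeq ▸ hΓ3⟩, fun t' Γ' h1 h2 => ha.2 t' Γ' h1 fun i hi => h2 i (hB₂S hi)⟩

theorem exists_lpOracle (hs : ∀ S : Finset (Fin n), S.Nonempty → S.card ≤ 26 →
      IsAnswer (gamutProgram q hq P S) (solver S)) :
    ∃ ans, LPOracle P solver ans ∧
      ∀ S, S.Nonempty → IsAnswer (gamutProgram q hq P S) (ans S) := by
  have hex : ∀ S : Finset (Fin n), ∃ a, S.Nonempty → IsAnswer (gamutProgram q hq P S) a := by
    intro S
    by_cases hS : S.Nonempty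
    · obtain ⟨B, -, -, -, h⟩ := exists_basis hq hs S hS
      exact ⟨_, fun _ => h⟩
    · exact ⟨none, fun h => (hS h).elim⟩
  choose ans hans using hex
  have hpass : ∀ (i : Fin n) (t : ℝ) (Γ : Gamut),
      PassesTest P i (some (t, Γ)) ↔ Γ.colors ⊆ (P i).colors := by
    intro i t Γ
    simp [PassesTest]
  refine ⟨ans, ⟨?_, ?_, ?_, ?_, ?_⟩, hans⟩
  · exact fun S hS hc => isAnswer_unique (hs S hS hc) (hans S hS)
  · intro S hS
    obtain ⟨B, h1, h2, h3, h4⟩ := exists_basis hq hs S hS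
    refine ⟨B, h1, h2, h3, ?_⟩
    rw [← isAnswer_unique h4 (hans S hS)]
    exact isAnswer_unique (hans B h2) (hs B h2 h3)
  · intro S T hS hST h
    have h1 := hans S hS
    rw [h, isAnswer_none_iff] at h1
    refine isAnswer_unique (hans T (hS.mono hST)) ?_
    rw [isAnswer_none_iff]
    exact fun Γ hΓ => h1 Γ fun i hi => hΓ i (hST hi)
  · intro S hS hne i hi
    obtain ⟨⟨t, Γ⟩, h⟩ := Option.ne_none_iff_exists'.1 hne
    have h1 := hans S hS
    rw [h, isAnswer_some_iff] at h1
    rw [h, hpass]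
    exact h1.1.2 i hi
  · intro S T hS hST hp
    have h1 := hans S hS
    refine isAnswer_unique (hans T (hS.mono hST)) ?_
    rcases h : ans S with _ | ⟨t, Γ⟩
    · obtain ⟨i, hi⟩ := hS
      have := hp i (hST hi)
      rw [h] at this
      simp [PassesTest] at this
    · rw [h, isAnswer_some_iff] at h1
      simp only [h, hpass] at hp
      rw [isAnswer_some_iff]
      exact ⟨⟨h1.1.1, hp⟩, fun t' Γ' h2 h3 => h1.2 t' Γ' h2 fun i hi => h3 i (hST hi)⟩

theorem IsAnswer.gamut_spec {a : Option (ℝ × Gamut)}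
    (h : IsAnswer (gamutProgram q hq P Finset.univ) a) :
    (∀ (t : ℝ) (Γ : Gamut), a = some (t, Γ) →
      (∀ i, Γ.colors ⊆ (P i).colors) ∧ t = gamutQuality q Γ ∧
      ∀ Γ' : Gamut, (∀ i, Γ'.colors ⊆ (P i).colors) → gamutQuality q Γ ≤ gamutQuality q Γ') ∧
    (a = none → ¬ ∃ Γ : Gamut, ∀ i, Γ.colors ⊆ (P i).colors) := by
  have hle : ∀ Γ c, cornerQuality q c Γ ≤ gamutQuality q Γ := fun Γ c =>
    Finset.le_sup' (fun c => cornerQuality q c Γ) (Finset.mem_univ c)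
  constructor
  · rintro t Γ rfl
    rw [isAnswer_some_iff] at h
    have hmin : ∀ Γ' : Gamut, (∀ i, Γ'.colors ⊆ (P i).colors) → t ≤ gamutQuality q Γ' := by
      intro Γ' h'
      rcases h.2 _ Γ' (hle Γ') fun i _ => h' i with h1 | h1
      · exact h1.le
      · exact h1.1.le
    have hf : ∀ i, Γ.colors ⊆ (P i).colors := fun i => h.1.2 i (Finset.mem_univ i)
    have ht : t = gamutQuality q Γ :=
      le_antisymm (hmin Γ hf) (Finset.sup'_le _ _ fun c _ => h.1.1 c)
    exact ⟨hf, ht, fun Γ' h' => ht ▸ hmin Γ' h'⟩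
  · rintro rfl ⟨Γ, hΓ⟩
    rw [isAnswer_none_iff] at h
    exact h Γ fun i _ => hΓ i

end

/-! ### Violators and the sampling lemma -/

section

variable {n : ℕ} {P : Fin n → Gamut} {solver ans : Finset (Fin n) → Option (ℝ × Gamut)}

/-- The projector `i` violates the solution `a`. The answer that a problem is infeasible is
violated by none. -/
def Violates (P : Fin n → Gamut) (a : Option (ℝ × Gamut)) (i : ℕ) : Prop :=
  a ≠ none ∧ ¬ PassesTest P i a

namespace LPOracle

/-- The answer for `B` satisfies every constraint of `T`, hence every constraint of `X`, and so
stays optimal there. -/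
theorem ans_eq_of_between (h : LPOracle P solver ans) {B X T : Finset (Fin n)} (hB : B.Nonempty)
    (hBX : B ⊆ X) (hXT : X ⊆ T) (hBT : ans B = ans T) : ans X = ans T := by
  by_cases hn : ans B = none
  · rw [h.none_mono B X hB hBX hn, ← hBT, hn]
  · rw [← hBT]
    refine h.ext B X hB hBX fun i hi => ?_
    rw [hBT] at hn ⊢
    exact h.passes T (hB.mono (hBX.trans hXT)) hn i (hXT hi)

theorem ans_eq_of_not_violates (h : LPOracle P solver ans) {S T : Finset (Fin n)} (hS : S.Nonempty)
    (hST : S ⊆ T) (hv : ∀ i : Fin n, i ∈ T → ¬ Violates P (ans S) i) : ans S = ans T := by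
  by_cases hn : ans S = none
  · rw [hn, h.none_mono S T hS hST hn]
  · exact (h.ext S T hS hST fun i hi => not_not.1 fun hp => hv i hi ⟨hn, hp⟩).symm

theorem not_violates_of_mem (h : LPOracle P solver ans) {S : Finset (Fin n)} {i : Fin n}
    (hi : i ∈ S) : ¬ Violates P (ans S) i :=
  fun hv => hv.2 (h.passes S ⟨i, hi⟩ hv.1 i hi)

/-- If no element of `B` violated the answer for `S`, adding `B` to `S` would not change it. But `S
∪ B` lies between `B` and `T`, so this would be the answer for `T`, which nothing in `T` violates.
This is what makes each successful round catch a new basis element. -/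
theorem exists_violates_of_basis (h : LPOracle P solver ans) {S B T : Finset (Fin n)}
    (hS : S.Nonempty) (hST : S ⊆ T) (hB : B.Nonempty) (hBT : B ⊆ T) (hans : ans B = ans T)
    {i : Fin n} (hi : i ∈ T) (hv : Violates P (ans S) i) : ∃ b ∈ B, Violates P (ans S) b := by
  classical
  by_contra! hno
  have h1 : ans S = ans (S ∪ B) := by
    refine h.ans_eq_of_not_violates hS Finset.subset_union_left fun j hj => ?_
    rcases Finset.mem_union.1 hj with hj | hj
    · exact h.not_violates_of_mem hj
    · exact hno j hj
  rw [h1, h.ans_eq_of_between hB Finset.subset_union_right (Finset.union_subset hST hBT) hans] at hv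
  exact h.not_violates_of_mem hi hv

-- Let `B` be a basis of `G` with all draws. If draw `p` violates the answer for the rest, some
-- element of `B` violates it too, and only the element `u p` can, since all others belong to the
-- rest. So `u p` lies in `B` and is drawn only once, which makes `u` injective on such positions.
open Classical in
theorem card_violates_others_le (h : LPOracle P solver ans) (G : Finset (Fin n)) {r : ℕ}
    (hr : 1 ≤ r) (u : Fin (r + 1) → Fin n) :
    (Finset.univ.filter fun p => Violates P
      (ans (G ∪ Finset.univ.image fun j => u (p.succAbove j))) (u p)).card ≤ 26 := by
  obtain ⟨B, hB, hB0, hBc, hBa⟩ := h.basis (G ∪ Finset.univ.image u) (by simp)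
  refine le_trans ?_ hBc
  have key : ∀ p, Violates P (ans (G ∪ Finset.univ.image fun j => u (p.succAbove j))) (u p) →
      u p ∈ B ∧ ∀ j, j ≠ p → u j ≠ u p := by
    intro p hp
    have hnot : u p ∉ G ∪ Finset.univ.image fun j => u (p.succAbove j) := fun hmem =>
      h.not_violates_of_mem hmem hp
    have hu : ∀ j, j ≠ p → u j ∈ G ∪ Finset.univ.image fun j => u (p.succAbove j) := by
      intro j hj
      obtain ⟨k, rfl⟩ := Fin.exists_succAbove_eq hj
      exact Finset.mem_union_right _ (Finset.mem_image_of_mem _ (Finset.mem_univ k))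
    have hsub : (G ∪ Finset.univ.image fun j => u (p.succAbove j)) ⊆ G ∪ Finset.univ.image u := by
      refine Finset.union_subset_union_right ?_
      intro x hx
      obtain ⟨j, -, rfl⟩ := Finset.mem_image.1 hx
      exact Finset.mem_image_of_mem _ (Finset.mem_univ _)
    obtain ⟨b, hb, hvb⟩ := h.exists_violates_of_basis (i := u p)
      ⟨u (p.succAbove ⟨0, hr⟩), hu _ (Fin.succAbove_ne _ _)⟩ hsub hB0 hB hBa
      (Finset.mem_union_right _ (Finset.mem_image_of_mem _ (Finset.mem_univ _))) hp
    have hbu : b = u p := by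
      rcases Finset.mem_union.1 (hB hb) with h' | h'
      · exact (h.not_violates_of_mem (Finset.mem_union_left _ h') hvb).elim
      · obtain ⟨j, -, rfl⟩ := Finset.mem_image.1 h'
        by_cases hj : j = p
        · rw [hj]
        · exact (h.not_violates_of_mem (hu j hj) hvb).elim
    exact ⟨hbu ▸ hb, fun j hj hju => hnot (hju ▸ hu j hj)⟩
  refine Finset.card_le_card_of_injOn u (fun p hp => (key p (Finset.mem_filter.1 hp).2).1) ?_
  intro p hp p' hp' heq
  by_contra hne
  exact (key p' (Finset.mem_filter.1 hp').2).2 p hne heq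

/-- The number of positions of a list whose elements violate a solution. -/
noncomputable def _root_.violations (P : Fin n → Gamut) {m : ℕ} (el : Fin m → Fin n)
    (a : Option (ℝ × Gamut)) : ℕ :=
  open Classical in (Finset.univ.filter fun x => Violates P a (el x)).card

open Classical in
/-- Clarkson's sampling lemma, for samples with replacement. -/
theorem sum_violations_le (h : LPOracle P solver ans) (G : Finset (Fin n)) {r m : ℕ}
    (hr : 1 ≤ r) (el : Fin m → Fin n) :
    (∑ t : Fin r → Fin m, violations P el (ans (G ∪ Finset.univ.image fun j => el (t j)))) *
      (r + 1) ≤ 26 * m ^ (r + 1) := by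
  -- Pairs of an `(r + 1)`-tuple and a violating position are counted twice: by tuples, with at most
  -- 26 positions each, and by positions, where each gives the same sum over `r`-tuples and one
  -- further draw.
  have h1 : ∑ u : Fin (r + 1) → Fin m, (Finset.univ.filter fun p => Violates P
      (ans (G ∪ Finset.univ.image fun j => el (u (p.succAbove j)))) (el (u p))).card ≤
      26 * m ^ (r + 1) := by
    refine (Finset.sum_le_card_nsmul _ _ 26 fun u _ =>
      h.card_violates_others_le G hr fun j => el (u j)).trans ?_
    simp [mul_comm]
  refine le_trans (le_of_eq ?_) h1
  simp only [Finset.card_filter]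
  rw [Finset.sum_comm]
  have h2 : ∀ p : Fin (r + 1), ∑ u : Fin (r + 1) → Fin m, (if Violates P
      (ans (G ∪ Finset.univ.image fun j => el (u (p.succAbove j)))) (el (u p)) then 1 else 0) =
      ∑ t : Fin r → Fin m, violations P el (ans (G ∪ Finset.univ.image fun j => el (t j))) := by
    intro p
    rw [← Fintype.sum_equiv (Fin.insertNthEquiv (fun _ => Fin m) p) (fun z => if Violates P
      (ans (G ∪ Finset.univ.image fun j => el (z.2 j))) (el z.1) then 1 else 0) _ (by
        rintro ⟨x, t⟩
        simp [Fin.insertNthEquiv])]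
    rw [Fintype.sum_prod_type_right]
    simp only [violations, Finset.card_filter]
  rw [Finset.sum_congr rfl fun p _ => h2 p]
  simp [mul_comm]

open Classical in
/-- At least half of the samples of size about `√m` have few violations. -/
theorem two_mul_card_many_violations_le (h : LPOracle P solver ans) (G : Finset (Fin n))
    {r m : ℕ} (hr : 1 ≤ r) (hm : m ≤ r * r) (el : Fin m → Fin n) :
    2 * (Finset.univ.filter fun t : Fin r → Fin m => 64 * r <
      violations P el (ans (G ∪ Finset.univ.image fun j => el (t j)))).card ≤ m ^ r := by
  have h1 := h.sum_violations_le G hr el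
  set N := (Finset.univ.filter fun t : Fin r → Fin m => 64 * r <
      violations P el (ans (G ∪ Finset.univ.image fun j => el (t j)))).card with hN
  have h2 : N * (64 * r) ≤
      ∑ t : Fin r → Fin m, violations P el (ans (G ∪ Finset.univ.image fun j => el (t j))) := by
    rw [hN, ← smul_eq_mul]
    refine (Finset.card_nsmul_le_sum _ _ _ fun t ht => (Finset.mem_filter.1 ht).2.le).trans ?_
    exact Finset.sum_le_sum_of_subset (Finset.filter_subset _ _)
  -- The mean number of violators is below `26 * r`, so Markov's inequality at `64 * r` gives a
  -- probability of at most one half.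
  have h3 : N * (64 * r) * (r + 1) ≤ 26 * (m ^ r * (r * r)) := by
    refine (Nat.mul_le_mul_right _ h2).trans (h1.trans ?_)
    rw [pow_succ]
    gcongr
  have hpos : 0 < r * r := by positivity
  refine le_of_mul_le_mul_right (a := 26 * (r * r)) ?_ (by positivity)
  nlinarith [Nat.zero_le (N * r), Nat.zero_le (N * (r * r))]

-- Some sample of 26 positions contains a basis, so a uniform one succeeds with probability at least
-- `1 / m ^ 26`.
open Classical in
theorem exists_sample_ans_eq (h : LPOracle P solver ans) {m : ℕ} (hm : 0 < m)
    (el : Fin m → Fin n) :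
    ∃ t : Fin 26 → Fin m,
      ans (Finset.univ.image fun j => el (t j)) = ans (Finset.univ.image el) := by
  obtain ⟨B, hB, hB0, hBc, hBa⟩ := h.basis (Finset.univ.image el)
    ⟨el ⟨0, hm⟩, Finset.mem_image_of_mem _ (Finset.mem_univ _)⟩
  have : Nonempty B := hB0.to_subtype
  obtain ⟨e⟩ : Nonempty (B ↪ Fin 26) := Function.Embedding.nonempty_of_card_le (by simpa using hBc)
  have hex : ∀ b : B, ∃ x, el x = b := fun b => by simpa using hB b.2
  choose φ hφ using hex
  -- Indices outside the range of `e` get arbitrary basis elements; repetitions do no harm.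
  refine ⟨fun j => φ (Function.invFun e j), h.ans_eq_of_between hB0 ?_ ?_ hBa⟩
  · intro b hb
    refine Finset.mem_image.2 ⟨e ⟨b, hb⟩, Finset.mem_univ _, ?_⟩
    dsimp only
    rw [Function.leftInverse_invFun e.injective, hφ]
  · intro x hx
    obtain ⟨j, -, rfl⟩ := Finset.mem_image.1 hx
    exact Finset.mem_image_of_mem _ (Finset.mem_univ _)

end LPOracle

end

-- The averaging step of both main loops: `β` and `α` are the remaining costs after bad and good
-- samples, and `F₀` is a common offset, which may be infinite.
open Classical in
theorem average_le {ι : Type*} [Fintype ι] [Nonempty ι] {bad : Finset ι} {F : ι → ℝ≥0∞} {F₀ : ℝ≥0∞}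
    {α β γ : ℕ} (hbad : ∀ t ∈ bad, F t ≤ β + F₀) (hgood : ∀ t ∉ bad, F t ≤ α + F₀)
    (h : bad.card * β + (Fintype.card ι - bad.card) * α ≤ Fintype.card ι * γ) :
    (∑ t, F t) / (Fintype.card ι : ℝ≥0∞) ≤ γ + F₀ := by
  have hF : ∀ t, F t ≤ (if t ∈ bad then β else α : ℕ) + F₀ := by
    intro t
    split_ifs with ht
    · exact hbad t ht
    · exact hgood t ht
  rw [ENNReal.div_le_iff (by simp) (by simp)]
  refine (Finset.sum_le_sum fun t _ => hF t).trans ?_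
  rw [Finset.sum_add_distrib, ← Nat.cast_sum, Finset.sum_ite, add_mul]
  simp only [Finset.sum_const, Finset.card_univ, nsmul_eq_mul, smul_eq_mul]
  rw [mul_comm F₀]
  gcongr
  rw [← Nat.cast_mul]
  refine Nat.cast_le.2 ?_
  have h1 : (Finset.univ.filter fun t => t ∈ bad) = bad := by simp
  have h2 : (Finset.univ.filter fun t => t ∉ bad).card = Fintype.card ι - bad.card := by
    rw [← Finset.card_compl]; congr 1; ext; simp
  rw [h1, h2, mul_comm γ]
  exact h

/-! ### Rules for expected-cost triples -/

section

variable {n : ℕ} {P : Fin n → Gamut} {solver : Finset (Fin n) → Option (ℝ × Gamut)}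

/-- From `s`, the program `p` ends in a store satisfying `Q`, after an expected number of at most
`c` steps. -/
def Tri (P : Fin n → Gamut) (solver : Finset (Fin n) → Option (ℝ × Gamut)) (s : Store) (p : Prog)
    (c : ℕ) (Q : Store → Prop) : Prop :=
  ∀ (f : Store → ℝ≥0∞) (F : ℝ≥0∞), (∀ s', Q s' → f s' ≤ F) → wp P solver p f s ≤ c + F

/-- The programs of a list, one after the other. -/
def seqs : List Prog → Prog
  | [] => .skip
  | p :: l => .seq p (seqs l)

namespace Tri

theorem conseq {s : Store} {p : Prog} {c c' : ℕ} {Q Q' : Store → Prop} (h : Tri P solver s p c Q)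
    (hc : c ≤ c') (hQ : ∀ s', Q s' → Q' s') : Tri P solver s p c' Q' := by
  intro f F hf
  refine (h f F fun s' hs' => hf s' (hQ s' hs')).trans ?_
  gcongr

theorem mono {s : Store} {p : Prog} {c c' : ℕ} {Q : Store → Prop} (h : Tri P solver s p c Q)
    (hc : c ≤ c') : Tri P solver s p c' Q :=
  h.conseq hc fun _ h => h

theorem of_wp_eq {s s' : Store} {p : Prog} {Q : Store → Prop}
    (h : ∀ f, wp P solver p f s = 1 + f s') (hQ : Q s') : Tri P solver s p 1 Q := by
  intro f F hf
  rw [h]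
  simpa using add_le_add_right (hf s' hQ) 1

theorem seq {s : Store} {p p' : Prog} {c c' : ℕ} {Q Q' : Store → Prop} (h : Tri P solver s p c Q)
    (h' : ∀ s', Q s' → Tri P solver s' p' c' Q') : Tri P solver s (.seq p p') (c + c' + 1) Q' := by
  intro f F hf
  simp only [wp]
  refine (add_le_add_right (h _ (c' + F) fun s' hs' => h' s' hs' f F hf) 1).trans (le_of_eq ?_)
  push_cast
  ring

theorem nil {s : Store} {Q : Store → Prop} (h : Q s) : Tri P solver s (seqs []) 1 Q :=
  of_wp_eq (fun _ => rfl) h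

theorem cons {s : Store} {p : Prog} {l : List Prog} {c c' : ℕ} {Q Q' : Store → Prop}
    (h : Tri P solver s p c Q) (h' : ∀ s', Q s' → Tri P solver s' (seqs l) c' Q') :
    Tri P solver s (seqs (p :: l)) (c + c' + 1) Q' :=
  h.seq h'

section

variable {s : Store} {l : List Prog} {c : ℕ} {Q : Store → Prop}

theorem const {x m : ℕ} (h : Tri P solver (s.setReg x m) (seqs l) c Q) :
    Tri P solver s (seqs (.const x m :: l)) (1 + c + 1) Q :=
  cons (Q := (· = s.setReg x m)) (of_wp_eq (fun _ => rfl) rfl) fun _ hs => hs ▸ h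

theorem add {x y z : ℕ} (h : Tri P solver (s.setReg x (s.reg y + s.reg z)) (seqs l) c Q) :
    Tri P solver s (seqs (.add x y z :: l)) (1 + c + 1) Q :=
  cons (Q := (· = s.setReg x (s.reg y + s.reg z))) (of_wp_eq (fun _ => rfl) rfl) fun _ hs => hs ▸ h

theorem sub {x y z : ℕ} (h : Tri P solver (s.setReg x (s.reg y - s.reg z)) (seqs l) c Q) :
    Tri P solver s (seqs (.sub x y z :: l)) (1 + c + 1) Q :=
  cons (Q := (· = s.setReg x (s.reg y - s.reg z))) (of_wp_eq (fun _ => rfl) rfl) fun _ hs => hs ▸ h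

theorem load {x y : ℕ} (h : Tri P solver (s.setReg x (s.mem (s.reg y))) (seqs l) c Q) :
    Tri P solver s (seqs (.load x y :: l)) (1 + c + 1) Q :=
  cons (Q := (· = s.setReg x (s.mem (s.reg y)))) (of_wp_eq (fun _ => rfl) rfl) fun _ hs => hs ▸ h

theorem store {x y : ℕ} (h : Tri P solver (s.setMem (s.reg x) (s.reg y)) (seqs l) c Q) :
    Tri P solver s (seqs (.store x y :: l)) (1 + c + 1) Q :=
  cons (Q := (· = s.setMem (s.reg x) (s.reg y))) (of_wp_eq (fun _ => rfl) rfl) fun _ hs => hs ▸ h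

open Classical in
theorem test {x y r : ℕ}
    (h : Tri P solver (s.setReg x (if PassesTest P (s.reg y) (s.sol r) then 1 else 0)) (seqs l) c Q) :
    Tri P solver s (seqs (.test x y r :: l)) (1 + c + 1) Q :=
  cons (Q := (· = s.setReg x (if PassesTest P (s.reg y) (s.sol r) then 1 else 0)))
    (of_wp_eq (fun _ => rfl) rfl) fun _ hs => hs ▸ h

theorem solve {r : ℕ} {ys : List ℕ}
    (h : Tri P solver (s.setSol r (solver {i | (i : ℕ) ∈ ys.map s.reg})) (seqs l) c Q) :
    Tri P solver s (seqs (.solve r ys :: l)) (1 + c + 1) Q :=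
  cons (Q := (· = s.setSol r (solver {i | (i : ℕ) ∈ ys.map s.reg})))
    (of_wp_eq (fun _ => rfl) rfl) fun _ hs => hs ▸ h

end

theorem skip {s : Store} {Q : Store → Prop} (h : Q s) : Tri P solver s .skip 1 Q :=
  of_wp_eq (fun _ => rfl) h

theorem ifLt {s : Store} {x y : ℕ} {p p' : Prog} {c : ℕ} {Q : Store → Prop}
    (h : s.reg x < s.reg y → Tri P solver s p c Q)
    (h' : ¬ s.reg x < s.reg y → Tri P solver s p' c Q) :
    Tri P solver s (.ifLt x y p p') (c + 1) Q := by
  intro f F hf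
  simp only [wp]
  have : (if s.reg x < s.reg y then wp P solver p f s else wp P solver p' f s) ≤ c + F := by
    split_ifs with hc
    · exact h hc f F hf
    · exact h' hc f F hf
  refine (add_le_add_right this 1).trans (le_of_eq ?_)
  push_cast
  ring

/-- A loop that runs exactly `N` times. -/
theorem whileLt {x y : ℕ} {p : Prog} {c : ℕ} {Q : Store → Prop} (J : ℕ → Store → Prop)
    (hJ : ∀ i s, J (i + 1) s → s.reg x < s.reg y ∧ Tri P solver s p c (J i))
    (hQ : ∀ s, J 0 s → ¬ s.reg x < s.reg y ∧ Q s) (N : ℕ) {s : Store} (hs : J N s) :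
    Tri P solver s (.whileLt x y p) (N * (c + 1) + 1) Q := by
  induction N generalizing s with
  | zero =>
    intro f F hf
    refine (wp_while_le x y p f s).trans ?_
    rw [if_neg (hQ s hs).1]
    simpa using add_le_add_right (hf s (hQ s hs).2) 1
  | succ N ih =>
    intro f F hf
    refine (wp_while_le x y p f s).trans ?_
    rw [if_pos (hJ N s hs).1]
    refine (add_le_add_right ((hJ N s hs).2 _ _ fun s' hs' => ih hs' f F hf) 1).trans (le_of_eq ?_)
    push_cast
    ring

end Tri

/-- A loop with a potential: `J i` are the possible stores with remaining cost `pot i`. -/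
theorem wp_while_le_potential {ι : Type*} {x y : ℕ} {p : Prog} {f : Store → ℝ≥0∞}
    (J : ι → Store → Prop) (pot : ι → ℝ≥0∞)
    (h : ∀ i s, J i s → 1 + (if s.reg x < s.reg y then
      wp P solver p (fun s' => ⨅ (j) (_ : J j s'), pot j) s else f s) ≤ pot i)
    {i : ι} {s : Store} (hs : J i s) : wp P solver (.whileLt x y p) f s ≤ pot i :=
  -- The infimum of the potentials available at a store is a prefixed point, so the index may depend
  -- on the random outcome.
  (wp_while_le_of (g := fun s' => ⨅ (j) (_ : J j s'), pot j)
    (fun s => le_iInf₂ fun i hi => h i s hi) s).trans (iInf₂_le i hs)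

/-! ### Drawing a uniform sample -/

/-- The straight-line program that appends a random element of the list `mem[reg o, …)` of length
`reg (o + 5) + 1` to the list that ends at `reg (o + 7)`. -/
def sampleBody (o : ℕ) : Prog :=
  seqs [.rand (o + 9) (o + 5), .add (o + 9) (o + 9) o, .load (o + 9) (o + 9),
    .store (o + 7) (o + 9), .add (o + 7) (o + 7) (o + 2), .add (o + 8) (o + 8) (o + 2)]

/-- Append `reg (o + 3)` independent random elements. -/
def sampleLoop (o : ℕ) : Prog := .whileLt (o + 8) (o + 3) (sampleBody o)

/-- The store after sampling the positions `t`. -/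
structure SamplePost (o k : ℕ) {m : ℕ} (t : Fin k → Fin m) (s s' : Store) : Prop where
  reg : ∀ x, x ≠ o + 7 → x ≠ o + 8 → x ≠ o + 9 → s'.reg x = s.reg x
  ptr : s'.reg (o + 7) = s.reg (o + 7) + k
  mem : ∀ y, y < s.reg (o + 7) → s'.mem y = s.mem y
  new : ∀ p : Fin k, s'.mem (s.reg (o + 7) + p) = s.mem (s.reg o + t p)

theorem wp_sampleLoop_le {o m k : ℕ} {s : Store} {f : Store → ℝ≥0∞} {F : (Fin k → Fin m) → ℝ≥0∞}
    (hone : s.reg (o + 2) = 1) (hm : s.reg (o + 5) + 1 = m)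
    (hk : s.reg (o + 8) + k = s.reg (o + 3)) (hptr : s.reg o + m ≤ s.reg (o + 7))
    (hF : ∀ t s', SamplePost o k t s s' → f s' ≤ F t) :
    wp P solver (sampleLoop o) f s ≤
      ((14 * k + 1 : ℕ) : ℝ≥0∞) + (∑ t, F t) / ((m ^ k : ℕ) : ℝ≥0∞) := by
  induction k generalizing s with
  | zero =>
    refine (wp_while_le _ _ _ f s).trans ?_
    rw [if_neg (by omega)]
    have := hF Fin.elim0 s ⟨fun _ _ _ _ => rfl, rfl, fun _ _ => rfl, fun p => p.elim0⟩
    simp only [Fintype.sum_unique, pow_zero, mul_zero, zero_add, Nat.cast_one, div_one]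
    gcongr
    exact this.trans (le_of_eq (congrArg F (Subsingleton.elim _ _)))
  | succ k ih =>
    refine (wp_while_le _ _ _ f s).trans ?_
    rw [if_pos (by omega)]
    subst hm
    -- The first draw is `v`, and the induction hypothesis averages over the other draws. The five
    -- remaining instructions cost 11 steps; the loop test, the sequencing and the draw bring an
    -- iteration to 14.
    have key : ∀ v : Fin (s.reg (o + 5) + 1),
        wp P solver (seqs [.add (o + 9) (o + 9) o, .load (o + 9) (o + 9),
          .store (o + 7) (o + 9), .add (o + 7) (o + 7) (o + 2), .add (o + 8) (o + 8) (o + 2)])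
          (wp P solver (sampleLoop o) f) (s.setReg (o + 9) v) ≤
        (11 : ℕ) + (((14 * k + 1 : ℕ) : ℝ≥0∞) +
          (∑ t, F (Fin.cons v t)) / (((s.reg (o + 5) + 1) ^ k : ℕ) : ℝ≥0∞)) := by
      intro v
      have hT : Tri P solver (s.setReg (o + 9) v) (seqs [.add (o + 9) (o + 9) o,
          .load (o + 9) (o + 9), .store (o + 7) (o + 9), .add (o + 7) (o + 7) (o + 2),
          .add (o + 8) (o + 8) (o + 2)]) 11 (fun s' =>
          (∀ x, x ≠ o + 7 → x ≠ o + 8 → x ≠ o + 9 → s'.reg x = s.reg x) ∧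
          s'.reg (o + 7) = s.reg (o + 7) + 1 ∧ s'.reg (o + 8) = s.reg (o + 8) + 1 ∧
          s'.mem = Function.update s.mem (s.reg (o + 7)) (s.mem (s.reg o + v))) := by
        refine Tri.mono (Tri.add <| Tri.load <| Tri.store <| Tri.add <| Tri.add <| Tri.nil ?_)
          (by norm_num)
        refine ⟨fun x h1 h2 h3 => ?_, ?_, ?_, ?_⟩ <;>
          simp [Store.setReg, Store.setMem, *, add_comm]
      refine hT _ _ fun s' hs' => ?_
      obtain ⟨h1, h2, h3, h4⟩ := hs'
      have e0 : s'.reg o = s.reg o := h1 _ (by omega) (by omega) (by omega)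
      have e2 : s'.reg (o + 2) = s.reg (o + 2) := h1 _ (by omega) (by omega) (by omega)
      have e3 : s'.reg (o + 3) = s.reg (o + 3) := h1 _ (by omega) (by omega) (by omega)
      have e5 : s'.reg (o + 5) = s.reg (o + 5) := h1 _ (by omega) (by omega) (by omega)
      refine ih (by omega) (by omega) (by omega) (by omega) fun t s'' hp => ?_
      refine hF _ _ ⟨fun x a b c => (hp.reg x a b c).trans (h1 x a b c), ?_, ?_, ?_⟩
      · rw [hp.ptr, h2]; omega
      · intro y hy
        rw [hp.mem y (by omega), h4, Function.update_of_ne (by omega)]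
      · intro p
        refine Fin.cases ?_ (fun p => ?_) p
        · simp only [Fin.val_zero, add_zero, Fin.cons_zero]
          rw [hp.mem _ (by omega), h4, Function.update_self]
        · have := hp.new p
          rw [h2, e0, h4, Function.update_of_ne (by have := (t p).2; omega)] at this
          rw [Fin.cons_succ, ← this, Fin.val_succ]
          congr 1
          omega
    rw [sampleBody, seqs]
    simp only [wp]
    calc _ ≤ 1 + (1 + (1 + (∑ v : Fin (s.reg (o + 5) + 1), ((11 : ℕ) + (((14 * k + 1 : ℕ) : ℝ≥0∞) +
          (∑ t, F (Fin.cons v t)) / (((s.reg (o + 5) + 1) ^ k : ℕ) : ℝ≥0∞)))) /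
          ((s.reg (o + 5) + 1 : ℕ) : ℝ≥0∞))) := by
          gcongr with v
          exact key v
      _ = _ := by
        have hM : ((s.reg (o + 5) + 1 : ℕ) : ℝ≥0∞) ≠ 0 := by simp
        have hM' : ((s.reg (o + 5) + 1 : ℕ) : ℝ≥0∞) ≠ ∞ := ENNReal.natCast_ne_top _
        have e1 : ∑ t : Fin (k + 1) → Fin (s.reg (o + 5) + 1), F t =
            ∑ v : Fin (s.reg (o + 5) + 1), ∑ t, F (Fin.cons v t) := by
          rw [← Fintype.sum_equiv (Fin.consEquiv fun _ => Fin (s.reg (o + 5) + 1))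
            (fun z => F (Fin.cons z.1 z.2)) F fun z => rfl, Fintype.sum_prod_type]
        rw [e1, Finset.sum_add_distrib, Finset.sum_add_distrib, Finset.sum_const, Finset.sum_const,
          Finset.card_univ, Fintype.card_fin, nsmul_eq_mul, nsmul_eq_mul, ENNReal.add_div,
          ENNReal.add_div, mul_comm, mul_comm (_ : ℝ≥0∞) ((14 * k + 1 : ℕ) : ℝ≥0∞),
          ENNReal.mul_div_cancel_right hM hM', ENNReal.mul_div_cancel_right hM hM']
        simp only [div_eq_mul_inv, ← Finset.sum_mul]
        rw [mul_assoc, ← ENNReal.mul_inv (Or.inr hM') (Or.inr hM), ← Nat.cast_mul, ← pow_succ]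
        push_cast
        ring

end

section

variable {n : ℕ} {P : Fin n → Gamut} {solver ans : Finset (Fin n) → Option (ℝ × Gamut)}

namespace Tri

variable {s : Store} {l : List Prog} {c : ℕ} {Q : Store → Prop}

theorem skip_cons (h : Tri P solver s (seqs l) c Q) :
    Tri P solver s (seqs (.skip :: l)) (1 + c + 1) Q :=
  cons (Q := (· = s)) (of_wp_eq (fun _ => rfl) rfl) fun _ hs => hs ▸ h

/-- The continuation is moved into both branches, so that no postcondition is needed where they
join. -/
theorem ifLt_cons {x y : ℕ} {p p' : Prog}
    (h : s.reg x < s.reg y → Tri P solver s (seqs (p :: l)) c Q)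
    (h' : ¬ s.reg x < s.reg y → Tri P solver s (seqs (p' :: l)) c Q) :
    Tri P solver s (seqs (.ifLt x y p p' :: l)) (c + 1) Q := by
  intro f F hf
  simp only [seqs, wp] at h h' ⊢
  have : 1 + (if s.reg x < s.reg y then wp P solver p (wp P solver (seqs l) f) s
      else wp P solver p' (wp P solver (seqs l) f) s) ≤ c + F := by
    split_ifs with hc
    · exact h hc f F hf
    · exact h' hc f F hf
  refine (add_le_add_right this 1).trans (le_of_eq ?_)
  push_cast
  ring

end Tri

/-! ### Lists in memory and the collection of violators -/

/-- The memory cells `mem[lo], …, mem[hi - 1]` hold the elements of `S`. -/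
def Holds (mem : ℕ → ℕ) (lo hi : ℕ) (S : Finset (Fin n)) : Prop :=
  ∀ i : ℕ, (∃ x, lo ≤ x ∧ x < hi ∧ mem x = i) ↔ ∃ j ∈ S, (j : ℕ) = i

theorem Holds.congr {mem mem' : ℕ → ℕ} {lo hi : ℕ} {S : Finset (Fin n)} (h : Holds mem lo hi S)
    (hm : ∀ x, lo ≤ x → x < hi → mem' x = mem x) : Holds mem' lo hi S := by
  intro i
  rw [← h i]
  refine exists_congr fun x => and_congr_right fun h1 => and_congr_right fun h2 => ?_
  rw [hm x h1 h2]

theorem Holds.empty (mem : ℕ → ℕ) (lo : ℕ) : Holds mem lo lo (∅ : Finset (Fin n)) := by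
  intro i
  simp only [Finset.notMem_empty, false_and, exists_false, iff_false]
  rintro ⟨x, h1, h2, -⟩
  omega

open Classical in
theorem Holds.union {mem : ℕ → ℕ} {lo mid hi : ℕ} {S T : Finset (Fin n)} (h : Holds mem lo mid S)
    (h' : Holds mem mid hi T) (h1 : lo ≤ mid) (h2 : mid ≤ hi) : Holds mem lo hi (S ∪ T) := by
  intro i
  simp only [Finset.mem_union, or_and_right, exists_or, ← h i, ← h' i]
  constructor
  · rintro ⟨x, ha, hb, hc⟩
    rcases lt_or_ge x mid with hx | hx
    · exact Or.inl ⟨x, ha, hx, hc⟩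
    · exact Or.inr ⟨x, hx, hb, hc⟩
  · rintro (⟨x, ha, hb, hc⟩ | ⟨x, ha, hb, hc⟩)
    · exact ⟨x, ha, by omega, hc⟩
    · exact ⟨x, by omega, hb, hc⟩

open Classical in
theorem Holds.of_fun {mem : ℕ → ℕ} {lo k : ℕ} {e : Fin k → Fin n}
    (h : ∀ p : Fin k, mem (lo + p) = e p) : Holds mem lo (lo + k) (Finset.univ.image e) := by
  intro i
  constructor
  · rintro ⟨x, h1, h2, h3⟩
    refine ⟨e ⟨x - lo, by omega⟩, Finset.mem_image_of_mem _ (Finset.mem_univ _), ?_⟩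
    rw [← h, ← h3]
    congr 1
    change lo + (x - lo) = x
    omega
  · rintro ⟨j, hj, rfl⟩
    obtain ⟨p, -, rfl⟩ := Finset.mem_image.1 hj
    exact ⟨lo + p, by omega, by omega, h p⟩

open Classical in
theorem Holds.exists_fun {mem : ℕ → ℕ} {lo k : ℕ} {S : Finset (Fin n)}
    (h : Holds mem lo (lo + k) S) :
    ∃ e : Fin k → Fin n, (∀ p : Fin k, mem (lo + p) = e p) ∧ S = Finset.univ.image e := by
  have hex : ∀ p : Fin k, ∃ j : Fin n, (j : ℕ) = mem (lo + p) := fun p => by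
    obtain ⟨j, -, hj⟩ := (h (mem (lo + p))).1 ⟨lo + p, by omega, by omega, rfl⟩
    exact ⟨j, hj⟩
  choose e he using hex
  refine ⟨e, fun p => (he p).symm, ?_⟩
  ext j
  have h1 := (h j).symm.trans (Holds.of_fun (fun p => (he p).symm) j)
  simpa [Fin.val_inj] using h1

open Classical in
/-- The elements at the positions before `i` that violate a solution. -/
noncomputable def violatorsBefore (P : Fin n → Gamut) {m : ℕ} (el : Fin m → Fin n)
    (a : Option (ℝ × Gamut)) (i : ℕ) : Finset (Fin m) :=
  Finset.univ.filter fun x => (x : ℕ) < i ∧ Violates P a (el x)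

open Classical in
/-- The elements of a list that violate a solution. -/
noncomputable def violators (P : Fin n → Gamut) {m : ℕ} (el : Fin m → Fin n)
    (a : Option (ℝ × Gamut)) : Finset (Fin n) :=
  (Finset.univ.filter fun x => Violates P a (el x)).image el

open Classical in
theorem violatorsBefore_succ {m : ℕ} (el : Fin m → Fin n) (a : Option (ℝ × Gamut)) {i : ℕ}
    (hi : i < m) : violatorsBefore P el a (i + 1) =
      if Violates P a (el ⟨i, hi⟩) then insert ⟨i, hi⟩ (violatorsBefore P el a i)
      else violatorsBefore P el a i := by
  ext x
  have h0 : (x : ℕ) < i + 1 ↔ x = ⟨i, hi⟩ ∨ (x : ℕ) < i := by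
    rw [Fin.ext_iff]
    change _ ↔ (x : ℕ) = i ∨ _
    omega
  split_ifs with h
  · simp only [violatorsBefore, Finset.mem_filter, Finset.mem_univ, true_and, Finset.mem_insert, h0]
    constructor
    · rintro ⟨h1 | h1, h2⟩
      · exact Or.inl h1
      · exact Or.inr ⟨h1, h2⟩
    · rintro (rfl | ⟨h1, h2⟩)
      · exact ⟨Or.inl rfl, h⟩
      · exact ⟨Or.inr h1, h2⟩
  · simp only [violatorsBefore, Finset.mem_filter, Finset.mem_univ, true_and, h0]
    constructor
    · rintro ⟨rfl | h1, h2⟩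
      · exact (h h2).elim
      · exact ⟨h1, h2⟩
    · rintro ⟨h1, h2⟩
      exact ⟨Or.inr h1, h2⟩

/-- Append the elements of the list `mem[reg o, reg (o + 1))` that violate the solution register
`0` to the list that ends at `reg (o + 11)`. -/
def countLoop (o : ℕ) : Prog :=
  -- Every element is written at the end pointer, which advances only when the test fails; an
  -- element that passes is overwritten or left past the end.
  .whileLt (o + 8) (o + 1) (seqs [.load (o + 9) (o + 8), .test (o + 10) (o + 9) 0,
    .store (o + 11) (o + 9), .ifLt (o + 13) (o + 10) .skip (.add (o + 11) (o + 11) (o + 2)),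
    .add (o + 8) (o + 8) (o + 2)])

/-- The store when the first `i` elements of a list have been inspected for violators. -/
structure CountState (P : Fin n → Gamut) (o g : ℕ) {m : ℕ} (el : Fin m → Fin n) (s : Store) (i : ℕ)
    (s' : Store) : Prop where
  le : i ≤ m
  reg : ∀ x, x ≠ o + 8 → x ≠ o + 9 → x ≠ o + 10 → x ≠ o + 11 → s'.reg x = s.reg x
  cnt : s'.reg (o + 8) = s.reg o + i
  ptr : s'.reg (o + 11) = g + (violatorsBefore P el (s.sol 0) i).card
  sol : s'.sol = s.sol
  mem : ∀ y, y < g → s'.mem y = s.mem y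
  new : open Classical in
    Holds s'.mem g (s'.reg (o + 11)) ((violatorsBefore P el (s.sol 0) i).image el)

theorem countLoop_spec {o g m : ℕ} {el : Fin m → Fin n} {s : Store} (hs : s.sol 0 ≠ none)
    (hone : s.reg (o + 2) = 1) (hzero : s.reg (o + 13) = 0) (hb : s.reg (o + 1) = s.reg o + m)
    (hg : s.reg o + m ≤ g) (hel : ∀ x : Fin m, s.mem (s.reg o + x) = el x)
    (hcnt : s.reg (o + 8) = s.reg o) (hptr : s.reg (o + 11) = g) :
    Tri P solver s (countLoop o) (13 * m + 1) (CountState P o g el s m) := by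
  classical
  have main : Tri P solver s (countLoop o) (m * (12 + 1) + 1) (CountState P o g el s m) := by
    refine Tri.whileLt (fun k s' => ∃ i, i + k = m ∧ CountState P o g el s i s') ?_ ?_ m
      ⟨0, by omega, ?_⟩
    · rintro k s' ⟨i, hik, h⟩
      have e1 : s'.reg (o + 1) = s.reg (o + 1) :=
        h.reg _ (by omega) (by omega) (by omega) (by omega)
      have e2 : s'.reg (o + 2) = 1 :=
        (h.reg _ (by omega) (by omega) (by omega) (by omega)).trans hone
      have e13 : s'.reg (o + 13) = 0 :=
        (h.reg _ (by omega) (by omega) (by omega) (by omega)).trans hzero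
      have hi : i < m := by omega
      refine ⟨by rw [h.cnt, e1, hb]; omega, ?_⟩
      have hx : s'.mem (s'.reg (o + 8)) = el ⟨i, hi⟩ := by
        rw [h.cnt, h.mem _ (by omega)]
        exact hel ⟨i, hi⟩
      have hsucc := violatorsBefore_succ (P := P) el (s.sol 0) hi
      by_cases hp : PassesTest P (el ⟨i, hi⟩) (s.sol 0)
      · rw [if_neg fun hv => hv.2 hp] at hsucc
        refine Tri.mono (Tri.load <| Tri.test <| Tri.store <| Tri.ifLt_cons (c := 5)
          (fun _ => Tri.mono (Tri.skip_cons <| Tri.add <| Tri.nil ?_) (by norm_num))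
          (fun hno => (hno ?_).elim)) (by norm_num)
        · refine ⟨i + 1, by omega, by omega, fun x h1 h2 h3 h4 => ?_, ?_, ?_, ?_, fun y hy => ?_, ?_⟩
          · simp [Store.setReg, Store.setMem, *, h.reg x h1 h2 h3 h4]
          · simp [Store.setReg, Store.setMem, *, h.cnt, add_assoc]
          · simp [Store.setReg, Store.setMem, *, h.ptr]
          · simp [Store.setReg, Store.setMem, h.sol]
          · have : y ≠ s'.reg (o + 11) := by rw [h.ptr]; omega
            simp [Store.setReg, Store.setMem, h.mem y hy, this]
          · rw [hsucc]
            have : (Store.setReg (Store.setMem (Store.setReg (Store.setReg s' (o + 9)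
              (s'.mem (s'.reg (o + 8)))) (o + 10) 1) (s'.reg (o + 11)) (s'.mem (s'.reg (o + 8))))
              (o + 8) (s'.reg (o + 8) + 1)).reg (o + 11) = s'.reg (o + 11) := by
              simp [Store.setReg, Store.setMem]
            refine Holds.congr (mem := s'.mem) ?_ fun x h1 h2 => ?_
            · simpa [Store.setReg, Store.setMem] using h.new
            · have : x ≠ s'.reg (o + 11) := by
                simp [Store.setReg, Store.setMem] at h2
                omega
              simp [Store.setReg, Store.setMem, this]
        · simp [Store.setReg, Store.setMem, *, h.sol]
      · rw [if_pos ⟨hs, hp⟩] at hsucc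
        refine Tri.mono (Tri.load <| Tri.test <| Tri.store <| Tri.ifLt_cons (c := 5)
          (fun hno => ?_) (fun _ => Tri.mono (Tri.add <| Tri.add <| Tri.nil ?_) (by norm_num)))
          (by norm_num)
        · simp [Store.setReg, Store.setMem, *, h.sol] at hno
        · have hcard : (violatorsBefore P el (s.sol 0) (i + 1)).card =
              (violatorsBefore P el (s.sol 0) i).card + 1 := by
            rw [hsucc, Finset.card_insert_of_notMem]
            simp [violatorsBefore]
          refine ⟨i + 1, by omega, by omega, fun x h1 h2 h3 h4 => ?_, ?_, ?_, ?_, fun y hy => ?_, ?_⟩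
          · simp [Store.setReg, Store.setMem, *, h.reg x h1 h2 h3 h4]
          · simp [Store.setReg, Store.setMem, *, h.cnt, add_assoc]
          · simp [Store.setReg, Store.setMem, hcard, h.ptr, e2, add_assoc]
          · simp [Store.setReg, Store.setMem, h.sol]
          · have : y ≠ s'.reg (o + 11) := by rw [h.ptr]; omega
            simp [Store.setReg, Store.setMem, h.mem y hy, this]
          · rw [hsucc, Finset.image_insert, Finset.insert_eq, Finset.union_comm]
            simp only [Store.setReg, Store.setMem]
            refine Holds.union (mid := s'.reg (o + 11)) (h.new.congr fun x h1 h2 => ?_) ?_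
              (by rw [h.ptr]; omega) (by simp)
            · rw [Function.update_of_ne]
              simp
              omega
            · have := Holds.of_fun (mem := Function.update s'.mem (s'.reg (o + 11)) (el ⟨i, hi⟩))
                (lo := s'.reg (o + 11)) (k := 1) (e := fun _ => el ⟨i, hi⟩) (by simp)
              simpa [hx, e2] using this
    · rintro s' ⟨i, hi, h⟩
      obtain rfl : i = m := by omega
      refine ⟨?_, h⟩
      rw [h.cnt, h.reg _ (by omega) (by omega) (by omega) (by omega)]
      omega
    · have h0 : violatorsBefore P el (s.sol 0) 0 = ∅ := by simp [violatorsBefore]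
      refine ⟨by omega, fun _ _ _ _ _ => rfl, by omega, by simp [h0, hptr], rfl, fun _ _ => rfl, ?_⟩
      rw [h0, hptr, Finset.image_empty]
      exact Holds.empty _ _
  exact main.mono (by omega)

/-- Evaluate a sampled solution: collect its violators, decide whether it is final, and otherwise
whether they are kept. -/
def finish (o : ℕ) : List Prog :=
  -- The machine has no test for `none`. The cell at `reg (o + 6)` holds the first sampled element,
  -- which passes exactly when the answer is not `none`; an infeasible answer thus skips the count
  -- and is final.
  [.load (o + 9) (o + 6), .test (o + 10) (o + 9) 0, .add (o + 11) (o + 6) (o + 13),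
    .add (o + 8) o (o + 13), .ifLt (o + 13) (o + 10) (countLoop o) .skip,
    .sub (o + 9) (o + 11) (o + 6),
    .ifLt (o + 13) (o + 9) (.ifLt (o + 4) (o + 9) .skip (.add (o + 6) (o + 11) (o + 13)))
      (.const (o + 12) 0)]

/-- Violators are written over the sample, directly behind the kept elements, so keeping them only
moves the end pointer `reg (o + 6)`. The register `o + 12` is the flag of the main loop. -/
structure FinishPost (P : Fin n → Gamut) (o : ℕ) {m : ℕ} (el : Fin m → Fin n) (s s' : Store) :
    Prop where
  reg : ∀ x, (x < o + 6 ∨ x = o + 13) → s'.reg x = s.reg x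
  sol : s'.sol = s.sol
  mem : ∀ y, y < s.reg (o + 6) → s'.mem y = s.mem y
  halt : violations P el (s.sol 0) = 0 → s'.reg (o + 12) = 0
  go : violations P el (s.sol 0) ≠ 0 → s'.reg (o + 12) = s.reg (o + 12)
  keep : violations P el (s.sol 0) ≤ s.reg (o + 4) →
    s'.reg (o + 6) = s.reg (o + 6) + violations P el (s.sol 0) ∧
    Holds s'.mem (s.reg (o + 6)) (s'.reg (o + 6)) (violators P el (s.sol 0))
  discard : s.reg (o + 4) < violations P el (s.sol 0) → s'.reg (o + 6) = s.reg (o + 6)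

theorem finish_spec {o m : ℕ} {el : Fin m → Fin n} {s : Store}
    (hone : s.reg (o + 2) = 1) (hzero : s.reg (o + 13) = 0) (hb : s.reg (o + 1) = s.reg o + m)
    (hg : s.reg o + m ≤ s.reg (o + 6)) (hel : ∀ x : Fin m, s.mem (s.reg o + x) = el x)
    (hnone : PassesTest P (s.mem (s.reg (o + 6))) (s.sol 0) ↔ s.sol 0 ≠ none) :
    Tri P solver s (seqs (finish o)) (13 * m + 20) (FinishPost P o el s) := by
  classical
  have hall : violatorsBefore P el (s.sol 0) m =
      Finset.univ.filter fun x => Violates P (s.sol 0) (el x) := by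
    ext x
    simp [violatorsBefore]
  refine Tri.mono (Tri.load <| Tri.test <| Tri.add <| Tri.add <|
    Tri.cons (c := 13 * m + 2) (c' := 8) (Q := fun s' =>
      (∀ x, x ≠ o + 8 → x ≠ o + 9 → x ≠ o + 10 → x ≠ o + 11 → s'.reg x = s.reg x) ∧
      s'.reg (o + 11) = s.reg (o + 6) + violations P el (s.sol 0) ∧ s'.sol = s.sol ∧
      (∀ y, y < s.reg (o + 6) → s'.mem y = s.mem y) ∧
      Holds s'.mem (s.reg (o + 6)) (s'.reg (o + 11)) (violators P el (s.sol 0))) ?_ ?_) (by omega)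
  · refine Tri.ifLt (fun hpos => ?_) (fun hpos => Tri.mono (Tri.skip ?_) (by omega))
    · have hs : s.sol 0 ≠ none := by
        rw [← hnone]
        by_contra hno
        simp [Store.setReg, hno, hzero] at hpos
      refine Tri.conseq (countLoop_spec (g := s.reg (o + 6)) (el := el) ?_ ?_ ?_ ?_ ?_ ?_ ?_ ?_) le_rfl
        fun s' h => ⟨fun x h1 h2 h3 h4 => ?_, ?_, ?_, fun y hy => ?_, ?_⟩
      · simpa [Store.setReg] using hs
      · simp [Store.setReg, hone]
      · simp [Store.setReg, hzero]
      · simp [Store.setReg, hb]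
      · simpa [Store.setReg] using hg
      · simpa [Store.setReg] using hel
      · simp [Store.setReg, hzero]
      · simp [Store.setReg, hzero]
      · rw [h.reg x h1 h2 h3 h4]
        simp [Store.setReg, *]
      · rw [h.ptr]
        simp [Store.setReg, hall, violations]
      · simp [h.sol, Store.setReg]
      · rw [h.mem y hy]
        simp [Store.setReg]
      · have := h.new
        simp only [Store.setReg, hall] at this
        exact this
    · have hs : s.sol 0 = none := by
        by_contra hno
        have := hnone.2 hno
        simp [Store.setReg, this, hzero] at hpos
      have hv : (Finset.univ.filter fun x => Violates P (s.sol 0) (el x)) = ∅ := by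
        simp [Violates, hs]
      refine ⟨fun x h1 h2 h3 h4 => ?_, ?_, ?_, fun y hy => ?_, ?_⟩
      · simp [Store.setReg, *]
      · simp [Store.setReg, violations, hv, hzero]
      · simp [Store.setReg]
      · simp [Store.setReg]
      · have := Holds.empty (n := n) s.mem (s.reg (o + 6))
        simpa [Store.setReg, violators, hv, hzero] using this
  · rintro s' ⟨h1, h2, h3, h4, h5⟩
    have e2 : s'.reg (o + 4) = s.reg (o + 4) := h1 _ (by omega) (by omega) (by omega) (by omega)
    have e6 : s'.reg (o + 6) = s.reg (o + 6) := h1 _ (by omega) (by omega) (by omega) (by omega)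
    have e12 : s'.reg (o + 12) = s.reg (o + 12) := h1 _ (by omega) (by omega) (by omega) (by omega)
    have e13 : s'.reg (o + 13) = 0 :=
      (h1 _ (by omega) (by omega) (by omega) (by omega)).trans hzero
    have hreg : ∀ x, (x < o + 6 ∨ x = o + 13) → x ≠ o + 6 ∧ x ≠ o + 9 ∧ x ≠ o + 12 ∧
        s'.reg x = s.reg x := fun x hx =>
      ⟨by omega, by omega, by omega, h1 x (by omega) (by omega) (by omega) (by omega)⟩
    refine Tri.mono (Tri.sub <| Tri.ifLt_cons (c := 4)
      (fun hpos => Tri.ifLt_cons (c := 3) (fun hthr => Tri.skip_cons <| Tri.nil ?_)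
        (fun hthr => Tri.add <| Tri.nil ?_))
      (fun hpos => Tri.mono (Tri.const <| Tri.nil ?_) (by norm_num))) (by norm_num)
    · simp [Store.setReg, h2, e2, e6, e13] at hpos hthr
      refine ⟨fun x hx => ?_, ?_, fun y hy => ?_, fun hv => ?_, fun hv => ?_, fun hv => ?_,
        fun hv => ?_⟩
      · obtain ⟨a1, a2, a3, a4⟩ := hreg x hx
        simp [Store.setReg, *]
      · simp [Store.setReg, *]
      · simp [Store.setReg, *]
      · omega
      · simp [Store.setReg, *]
      · omega
      · simp [Store.setReg, *]
    · simp [Store.setReg, h2, e2, e6, e13] at hpos hthr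
      refine ⟨fun x hx => ?_, ?_, fun y hy => ?_, fun hv => ?_, fun hv => ?_, fun hv => ⟨?_, ?_⟩,
        fun hv => ?_⟩
      · obtain ⟨a1, a2, a3, a4⟩ := hreg x hx
        simp [Store.setReg, *]
      · simp [Store.setReg, *]
      · simp [Store.setReg, *]
      · omega
      · simp [Store.setReg, *]
      · simp [Store.setReg, *]
      · simpa [Store.setReg, e13] using h5
      · omega
    · simp [Store.setReg, h2, e6, e13] at hpos
      refine ⟨fun x hx => ?_, ?_, fun y hy => ?_, fun hv => ?_, fun hv => ?_, fun hv => ⟨?_, ?_⟩,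
        fun hv => ?_⟩
      · obtain ⟨a1, a2, a3, a4⟩ := hreg x hx
        simp [Store.setReg, *]
      · simp [Store.setReg, *]
      · simp [Store.setReg, *]
      · simp [Store.setReg]
      · omega
      · simp [Store.setReg, *]
      · rw [h2, hpos, add_zero] at h5
        simpa [Store.setReg, e6] using h5
      · omega

end

/-! ### Rounds of the algorithm and their expected number -/

section

variable {n : ℕ} {P : Fin n → Gamut} {solver ans : Finset (Fin n) → Option (ℝ × Gamut)}

/-- The program `p` solves, at a cost of at most `c`, the problem of a list of length `L` between
the addresses in the registers `o` and `o + 1`. It leaves the registers below `o` and the memory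
up to the end of the list intact. -/
def Solves (P : Fin n → Gamut) (solver ans : Finset (Fin n) → Option (ℝ × Gamut)) (p : Prog)
    (o L c : ℕ) : Prop :=
  ∀ (s : Store) (S : Finset (Fin n)), s.reg (o + 1) = s.reg o + L →
    Holds s.mem (s.reg o) (s.reg o + L) S →
    Tri P solver s p c fun s' => (∀ x, x < o → s'.reg x = s.reg x) ∧
      (∀ y, y < s.reg o + L → s'.mem y = s.mem y) ∧ s'.sol 0 = ans S

/-- One round of Clarkson's algorithm: solve the kept elements together with a random sample. -/
def clarksonRound (o : ℕ) (callee : Prog) : Prog :=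
  -- The memory holds the given list, the kept elements and the sample, in this order. The callee
  -- gets the last two as one contiguous list, and its registers start at `o + 16`.
  seqs (.add (o + 7) (o + 6) (o + 13) :: .const (o + 8) 0 :: sampleLoop o ::
    .add (o + 16) (o + 1) (o + 13) :: .add (o + 17) (o + 7) (o + 13) :: callee :: finish o)

/-- The store between two rounds, for a list of length `m` that was given in the store `s₀`.
The set `G` of kept elements is stored in a list of length `len`. -/
structure RoundState (o m r thr len : ℕ) (G : Finset (Fin n)) (s₀ s : Store) : Prop where
  low : ∀ x, x ≤ o → s.reg x = s₀.reg x
  hi : s.reg (o + 1) = s₀.reg o + m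
  one : s.reg (o + 2) = 1
  size : s.reg (o + 3) = r
  thr : s.reg (o + 4) = thr
  max : s.reg (o + 5) + 1 = m
  zero : s.reg (o + 13) = 0
  top : s.reg (o + 6) = s₀.reg o + m + len
  mem : ∀ y, y < s₀.reg o + m → s.mem y = s₀.mem y
  kept : Holds s.mem (s₀.reg o + m) (s₀.reg o + m + len) G

open Classical in
/-- The store after a round with the sample `t`. -/
structure RoundPost (P : Fin n → Gamut) (ans : Finset (Fin n) → Option (ℝ × Gamut))
    (o m r thr len : ℕ) (G : Finset (Fin n)) (s₀ : Store) (el : Fin m → Fin n) (t : Fin r → Fin m)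
    (s' : Store) : Prop where
  sol : s'.sol 0 = ans (G ∪ Finset.univ.image fun j => el (t j))
  halt : violations P el (s'.sol 0) = 0 → s'.reg (o + 12) = 0
  go : violations P el (s'.sol 0) ≠ 0 → s'.reg (o + 12) = 1
  keep : violations P el (s'.sol 0) ≤ thr →
    RoundState o m r thr (len + violations P el (s'.sol 0)) (G ∪ violators P el (s'.sol 0)) s₀ s'
  discard : thr < violations P el (s'.sol 0) → RoundState o m r thr len G s₀ s'

theorem wp_round_le (h : LPOracle P solver ans) {o m r thr len K : ℕ} {G : Finset (Fin n)}
    {s₀ s : Store} {el : Fin m → Fin n} {callee : Prog} (hel : ∀ x : Fin m, s₀.mem (s₀.reg o + x) = el x)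
    (hs : RoundState o m r thr len G s₀ s) (hgo : s.reg (o + 12) = 1) (hr : 1 ≤ r)
    (hcal : Solves P solver ans callee (o + 16) (len + r) K) {f : Store → ℝ≥0∞}
    {F : (Fin r → Fin m) → ℝ≥0∞}
    (hF : ∀ t s', RoundPost P ans o m r thr len G s₀ el t s' → f s' ≤ F t) :
    wp P solver (clarksonRound o callee) f s ≤ ((14 * r + K + 13 * m + 31 : ℕ) : ℝ≥0∞) +
      (∑ t, F t) / ((m ^ r : ℕ) : ℝ≥0∞) := by
  classical
  have hm : 0 < m := by have := hs.max; omega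
  have elo : s.reg o = s₀.reg o := hs.low o le_rfl
  simp only [clarksonRound, seqs, wp]
  set s₁ := (s.setReg (o + 7) (s.reg (o + 6) + s.reg (o + 13))).setReg (o + 8) 0 with hs₁
  have r1 : ∀ x, x ≠ o + 7 → x ≠ o + 8 → s₁.reg x = s.reg x := fun x h1 h2 => by
    simp [hs₁, Store.setReg, h1, h2]
  have r7 : s₁.reg (o + 7) = s₀.reg o + m + len := by
    simp [hs₁, Store.setReg, hs.zero, hs.top]
  have r8 : s₁.reg (o + 8) = 0 := by simp [hs₁, Store.setReg]
  have m1 : s₁.mem = s.mem := rfl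
  have key := wp_sampleLoop_le (P := P) (solver := solver) (o := o) (m := m) (k := r) (s := s₁)
    (f := wp P solver (seqs (.add (o + 16) (o + 1) (o + 13) ::
      .add (o + 17) (o + 7) (o + 13) :: callee :: finish o)) f)
    (F := fun t => ((K + 13 * m + 25 : ℕ) : ℝ≥0∞) + F t)
    ((r1 _ (by omega) (by omega)).trans hs.one)
    (by rw [r1 _ (by omega) (by omega)]; exact hs.max)
    (by rw [r8, r1 _ (by omega) (by omega), hs.size]; omega)
    (by rw [r7, r1 _ (by omega) (by omega), elo]; omega) ?_
  · simp only [seqs, wp] at key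
    refine (add_le_add_right (add_le_add_right (add_le_add_right (add_le_add_right
      (add_le_add_right key 1) 1) 1) 1) 1).trans (le_of_eq ?_)
    rw [Finset.sum_add_distrib, Finset.sum_const, Finset.card_univ, ENNReal.add_div, nsmul_eq_mul,
      Fintype.card_fun, Fintype.card_fin, Fintype.card_fin, mul_comm ((m ^ r : ℕ) : ℝ≥0∞),
      ENNReal.mul_div_cancel_right (by simp; omega) (ENNReal.natCast_ne_top _)]
    push_cast
    ring
  intro t s₂ hp
  have q1 : ∀ x, x ≠ o + 7 → x ≠ o + 8 → x ≠ o + 9 → s₂.reg x = s.reg x := fun x h1 h2 h3 =>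
    (hp.reg x h1 h2 h3).trans (r1 x h1 h2)
  have q7 : s₂.reg (o + 7) = s₀.reg o + m + len + r := by rw [hp.ptr, r7]
  have qm : ∀ y, y < s₀.reg o + m + len → s₂.mem y = s.mem y := fun y hy => by
    rw [hp.mem y (by omega), m1]
  have qn : ∀ p : Fin r, s₂.mem (s₀.reg o + m + len + p) = el (t p) := fun p => by
    have := hp.new p
    rw [r7, r1 _ (by omega) (by omega), elo, m1, hs.mem _ (by omega), hel] at this
    exact this
  refine (show Tri P solver s₂ _ (K + 13 * m + 25)
    (RoundPost P ans o m r thr len G s₀ el t) from ?_) f (F t) fun s' hs' => hF t s' hs'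
  have q0 : s₂.reg o = s₀.reg o := (q1 _ (by omega) (by omega) (by omega)).trans elo
  have qb : s₂.reg (o + 1) = s₀.reg o + m := (q1 _ (by omega) (by omega) (by omega)).trans hs.hi
  have qz : s₂.reg (o + 13) = 0 := (q1 _ (by omega) (by omega) (by omega)).trans hs.zero
  have hH : Holds s₂.mem (s₀.reg o + m) (s₀.reg o + m + (len + r))
      (G ∪ Finset.univ.image fun j => el (t j)) := by
    rw [← add_assoc]
    exact (hs.kept.congr fun x h1 h2 => qm x h2).union (Holds.of_fun qn) (by omega) (by omega)
  refine Tri.mono (Tri.add <| Tri.add <| Tri.cons (c := K) (c' := 13 * m + 20)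
    (hcal _ (G ∪ Finset.univ.image fun j => el (t j)) ?_ ?_) ?_) (by omega)
  · simp [Store.setReg, qb, qz, q7]
    omega
  · simpa [Store.setReg, qb, qz] using hH
  rintro s₃ ⟨k1, k2, k3⟩
  have p1 : ∀ x, x ≠ o + 7 → x ≠ o + 8 → x ≠ o + 9 → x < o + 16 → s₃.reg x = s.reg x :=
    fun x h1 h2 h3 h4 => by
      rw [k1 x h4, ← q1 x h1 h2 h3]
      have : x ≠ o + 17 := by omega
      have : x ≠ o + 16 := by omega
      simp [Store.setReg, *]
  have pm : ∀ y, y < s₀.reg o + m + (len + r) → s₃.mem y = s₂.mem y := fun y hy =>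
    k2 y (by simpa [Store.setReg, qb, qz] using hy)
  have p0 : s₃.reg o = s₀.reg o :=
    (p1 _ (by omega) (by omega) (by omega) (by omega)).trans elo
  have p6 : s₃.reg (o + 6) = s₀.reg o + m + len :=
    (p1 _ (by omega) (by omega) (by omega) (by omega)).trans hs.top
  have p4 : s₃.reg (o + 4) = thr :=
    (p1 _ (by omega) (by omega) (by omega) (by omega)).trans hs.thr
  refine Tri.conseq (finish_spec (el := el) ?_ ?_ ?_ ?_ ?_ ?_) le_rfl fun s' hf => ?_
  · exact (p1 _ (by omega) (by omega) (by omega) (by omega)).trans hs.one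
  · exact (p1 _ (by omega) (by omega) (by omega) (by omega)).trans hs.zero
  · rw [p0]; exact (p1 _ (by omega) (by omega) (by omega) (by omega)).trans hs.hi
  · rw [p0, p6]; omega
  · intro x
    rw [p0, pm _ (by omega), qm _ (by omega), hs.mem _ (by omega), hel]
  · have hz := qn ⟨0, hr⟩
    simp only [add_zero] at hz
    rw [p6, pm _ (by omega), hz, k3]
    refine ⟨fun hpass hn => ?_, fun hn => ?_⟩
    · rw [hn] at hpass
      obtain ⟨_, p, hp, _⟩ := hpass
      simp at hp
    · exact h.passes _ ⟨el (t ⟨0, hr⟩), by simp⟩ hn _ (by simp)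
  · have hstate : ∀ (len' : ℕ) (G' : Finset (Fin n)), s'.reg (o + 6) = s₀.reg o + m + len' →
        Holds s'.mem (s₀.reg o + m) (s₀.reg o + m + len') G' →
        RoundState o m r thr len' G' s₀ s' := by
      intro len' G' h1 h2
      have f1 : ∀ x, x < o + 6 ∨ x = o + 13 → s'.reg x = s.reg x := fun x hx =>
        (hf.reg x hx).trans (p1 x (by omega) (by omega) (by omega) (by omega))
      refine ⟨fun x hx => (f1 x (by omega)).trans (hs.low x hx), (f1 _ (by omega)).trans hs.hi,
        (f1 _ (by omega)).trans hs.one, (f1 _ (by omega)).trans hs.size,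
        (f1 _ (by omega)).trans hs.thr, by rw [f1 _ (by omega)]; exact hs.max,
        (f1 _ (by omega)).trans hs.zero, h1, fun y hy => ?_, h2⟩
      rw [hf.mem y (by omega), pm y (by omega), qm y (by omega), hs.mem y hy]
    have hG : Holds s'.mem (s₀.reg o + m) (s₀.reg o + m + len) G :=
      hs.kept.congr fun x h1 h2 => by
        rw [hf.mem x (by omega), pm x (by omega), qm x (by omega)]
    refine ⟨?_, ?_, ?_, ?_, ?_⟩
    · rw [hf.sol, k3]
    · rw [hf.sol]; exact hf.halt
    · rw [hf.sol]
      intro hv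
      rw [hf.go hv, p1 _ (by omega) (by omega) (by omega) (by omega), hgo]
    · rw [hf.sol]
      intro hv
      obtain ⟨e1, e2⟩ := hf.keep (p4 ▸ hv)
      rw [p6] at e1
      rw [e1, p6] at e2
      refine hstate _ _ (by rw [e1]; omega) ?_
      rw [← add_assoc]
      exact hG.union e2 (by omega) (by omega)
    · rw [hf.sol]
      intro hv
      exact hstate _ _ ((hf.discard (p4 ▸ hv)).trans p6) hG

/-- Rounds until there is no violator. -/
def mainLoop (o : ℕ) (callee : Prog) : Prog := .whileLt (o + 13) (o + 12) (clarksonRound o callee)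

theorem violations_eq_zero_iff {m : ℕ} {el : Fin m → Fin n} {a : Option (ℝ × Gamut)} :
    violations P el a = 0 ↔ ∀ x, ¬ Violates P a (el x) := by
  simp [violations, Finset.filter_eq_empty_iff]

-- The stopping test is sound: an answer for part of the list that nothing in the list violates is
-- the answer for the whole list.
open Classical in
theorem LPOracle.ans_eq_of_violations_eq_zero (h : LPOracle P solver ans) {m r : ℕ} (hr : 1 ≤ r)
    {el : Fin m → Fin n} {G : Finset (Fin n)} (hG : G ⊆ Finset.univ.image el) {t : Fin r → Fin m}
    (hv : violations P el (ans (G ∪ Finset.univ.image fun j => el (t j))) = 0) :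
    ans (G ∪ Finset.univ.image fun j => el (t j)) = ans (Finset.univ.image el) := by
  refine h.ans_eq_of_not_violates ⟨el (t ⟨0, hr⟩), by simp⟩ (Finset.union_subset hG ?_) ?_
  · intro x hx
    obtain ⟨j, -, rfl⟩ := Finset.mem_image.1 hx
    simp
  · intro i hi
    obtain ⟨x, -, rfl⟩ := Finset.mem_image.1 hi
    exact violations_eq_zero_iff.1 hv x

open Classical in
/-- Rejection of samples that do not contain a basis: a solver for constant-size problems solves
all problems. -/
theorem mainLoop_reject (h : LPOracle P solver ans) {o m K : ℕ} {s₀ s : Store} {el : Fin m → Fin n}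
    {callee : Prog} (hel : ∀ x : Fin m, s₀.mem (s₀.reg o + x) = el x)
    (hs : RoundState o m 26 0 0 (∅ : Finset (Fin n)) s₀ s) (hgo : s.reg (o + 12) = 1)
    (hcal : Solves P solver ans callee (o + 16) 26 K) :
    Tri P solver s (mainLoop o callee) (m ^ 26 * (14 * 26 + K + 13 * m + 42) + 1)
      fun s' => (∀ x, x < o → s'.reg x = s₀.reg x) ∧ (∀ y, y < s₀.reg o + m → s'.mem y = s₀.mem y) ∧
        s'.sol 0 = ans (Finset.univ.image el) := by
  intro f F hf
  have hm : 0 < m := by have := hs.max; omega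
  have : Nonempty (Fin m) := ⟨⟨0, hm⟩⟩
  set c := 14 * 26 + K + 13 * m + 42 with hc
  have hM : 0 < m ^ 26 := by positivity
  -- The index says whether the loop is still running. As the threshold is 0, nothing is ever kept
  -- and all rounds start alike.
  refine wp_while_le_potential (ι := Bool)
    (fun b s' => bif b then s'.reg (o + 12) = 1 ∧ RoundState o m 26 0 0 (∅ : Finset (Fin n)) s₀ s'
      else s'.reg (o + 12) = 0 ∧ f s' ≤ F)
    (fun b => ((bif b then m ^ 26 * c + 1 else 1 : ℕ) : ℝ≥0∞) + F) ?_ (i := true) ⟨hgo, hs⟩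
  rintro (_ | _) s ⟨h1, h2⟩
  · rw [if_neg (by omega)]
    simpa using add_le_add_right h2 1
  · rw [if_pos (by rw [h1, h2.zero]; omega)]
    set bad : Finset (Fin 26 → Fin m) := Finset.univ.filter fun t =>
      ans (Finset.univ.image fun j => el (t j)) ≠ ans (Finset.univ.image el) with hbad
    have hcard : bad.card < m ^ 26 := by
      obtain ⟨t, ht⟩ := h.exists_sample_ans_eq hm el
      have : bad ⊂ Finset.univ := Finset.filter_ssubset.2 ⟨t, Finset.mem_univ _, by simpa using ht⟩
      simpa using Finset.card_lt_card this
    refine (add_le_add_right (wp_round_le h hel h2 h1 (by norm_num) (by simpa using hcal)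
      (F := fun t => ((if t ∈ bad then m ^ 26 * c + 1 else 1 : ℕ) : ℝ≥0∞) + F) ?_) 1).trans ?_
    · intro t s' hp
      have hsol := hp.sol
      rw [Finset.empty_union] at hsol
      by_cases hv : violations P el (s'.sol 0) = 0
      · have hJ : s'.reg (o + 12) = 0 ∧ f s' ≤ F := by
          have hst := hp.keep (by omega)
          refine ⟨hp.halt hv, hf s' ⟨fun x hx => hst.low x hx.le, hst.mem, ?_⟩⟩
          have := h.ans_eq_of_violations_eq_zero (G := ∅) (r := 26) (by norm_num) (by simp)
            (t := t) (el := el) (by rw [← hp.sol]; exact hv)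
          rw [hp.sol, this]
        refine (iInf₂_le false hJ).trans ?_
        gcongr
        simp only [cond_false]
        split_ifs <;> omega
      · have ht : t ∈ bad := by
          rw [hbad, Finset.mem_filter]
          refine ⟨Finset.mem_univ _, fun heq => hv ?_⟩
          rw [violations_eq_zero_iff]
          intro x
          rw [hsol, heq]
          exact h.not_violates_of_mem (by simp)
        refine (iInf₂_le true ⟨hp.go hv, hp.discard (by omega)⟩).trans ?_
        rw [if_pos ht]
        rfl
    -- At least one of the `m ^ 26` samples is good, so a round lowers the mean potential by at
    -- least `c`, which pays for it.
    · have havg := average_le (bad := bad) (F := fun t =>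
        ((if t ∈ bad then m ^ 26 * c + 1 else 1 : ℕ) : ℝ≥0∞) + F) (F₀ := F) (α := 1)
        (β := m ^ 26 * c + 1) (γ := (m ^ 26 - 1) * c + 1) 
        (fun t ht => by rw [if_pos ht]) (fun t ht => by rw [if_neg ht]) (by
          rw [Fintype.card_fun, Fintype.card_fin, Fintype.card_fin]
          obtain ⟨N, hN⟩ : ∃ N, m ^ 26 = N + 1 := ⟨m ^ 26 - 1, by omega⟩
          rw [hN] at hcard ⊢
          obtain ⟨k, rfl⟩ : ∃ k, N = bad.card + k := ⟨N - bad.card, by omega⟩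
          have e1 : bad.card + k + 1 - bad.card = k + 1 := by omega
          rw [e1, Nat.add_sub_cancel]
          nlinarith [Nat.zero_le (k * c), Nat.zero_le (k * (bad.card + k + 1) * c)])
      rw [Fintype.card_fun, Fintype.card_fin, Fintype.card_fin] at havg
      refine (add_le_add_right (add_le_add_right havg _) 1).trans ?_
      rw [← add_assoc, ← add_assoc]
      gcongr
      rw [← Nat.cast_one, ← Nat.cast_add, ← Nat.cast_add]
      refine Nat.cast_le.2 ?_
      obtain ⟨N, hN⟩ : ∃ N, m ^ 26 = N + 1 := ⟨m ^ 26 - 1, by omega⟩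
      rw [hN, Nat.add_sub_cancel, cond_true, add_mul]
      omega

open Classical in
/-- Clarkson's algorithm reduces a problem of size `m` to problems of size about `√m`. -/
theorem mainLoop_clarkson (h : LPOracle P solver ans) {o m r K : ℕ} {s₀ s : Store}
    {el : Fin m → Fin n} {callee : Prog} (hel : ∀ x : Fin m, s₀.mem (s₀.reg o + x) = el x)
    (hr : 1 ≤ r) (hmr : m ≤ r * r)
    (hs : RoundState o m r (64 * r) 0 (∅ : Finset (Fin n)) s₀ s) (hgo : s.reg (o + 12) = 1)
    (hcal : ∀ L, 1 ≤ L → L ≤ 1665 * r → Solves P solver ans callee (o + 16) L K) :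
    Tri P solver s (mainLoop o callee) (54 * (14 * r + K + 13 * m + 42) + 1)
      fun s' => (∀ x, x < o → s'.reg x = s₀.reg x) ∧ (∀ y, y < s₀.reg o + m → s'.mem y = s₀.mem y) ∧
        s'.sol 0 = ans (Finset.univ.image el) := by
  intro f F hf
  have hm : 0 < m := by have := hs.max; omega
  have : Nonempty (Fin m) := ⟨⟨0, hm⟩⟩
  set c := 14 * r + K + 13 * m + 42 with hc
  obtain ⟨B, hB, hB0, hBc, hBa⟩ := h.basis (Finset.univ.image el)
    ⟨el ⟨0, hm⟩, Finset.mem_image_of_mem _ (Finset.mem_univ _)⟩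
  -- Index 0 means finished; index `d + 1` means that at most `d` elements of the basis `B` are not
  -- yet kept. At most `64 * r` elements are kept per success, so the callee's list has length at
  -- most `26 * 64 * r + r = 1665 * r`.
  refine (wp_while_le_potential (ι := ℕ)
    (fun i s' => (i = 0 → s'.reg (o + 12) = 0 ∧ s'.reg (o + 13) = 0 ∧ f s' ≤ F) ∧
      ∀ d, i = d + 1 → s'.reg (o + 12) = 1 ∧ ∃ len G, RoundState o m r (64 * r) len G s₀ s' ∧
        G ⊆ Finset.univ.image el ∧ (B \ G).card ≤ d ∧ len + 64 * r * d ≤ 64 * r * 26)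
    (fun i => ((2 * i * c + 1 : ℕ) : ℝ≥0∞) + F) ?_ (i := 27) ⟨by simp, ?_⟩).trans (by simp)
  swap
  · rintro d hd
    obtain rfl : d = 26 := by omega
    exact ⟨hgo, 0, ∅, hs, by simp, by simpa using hBc, by omega⟩
  rintro (_ | d) s hJ
  · obtain ⟨h1, h2, h3⟩ := hJ.1 rfl
    rw [if_neg (by omega)]
    simpa using add_le_add_right h3 1
  · obtain ⟨h1, len, G, h2, hG, hd, hlen⟩ := hJ.2 d rfl
    rw [if_pos (by rw [h1, h2.zero]; omega)]
    set bad : Finset (Fin r → Fin m) := Finset.univ.filter fun t => 64 * r <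
      violations P el (ans (G ∪ Finset.univ.image fun j => el (t j))) with hbad
    have hcard : 2 * bad.card ≤ m ^ r := h.two_mul_card_many_violations_le G hr hmr el
    refine (add_le_add_right (wp_round_le h hel h2 h1 hr
      (hcal _ (by omega) (by nlinarith [Nat.zero_le (64 * r * d)]))
      (F := fun t => ((if t ∈ bad then 2 * (d + 1) * c + 1 else 2 * d * c + 1 : ℕ) : ℝ≥0∞) + F)
      ?_) 1).trans ?_
    · intro t s' hp
      by_cases hv : violations P el (s'.sol 0) = 0
      · have hst := hp.keep (by omega)
        have hsol : s'.sol 0 = ans (Finset.univ.image el) := by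
          rw [hp.sol]
          exact h.ans_eq_of_violations_eq_zero hr hG (by rw [← hp.sol]; exact hv)
        refine (iInf₂_le 0 ⟨fun _ => ⟨hp.halt hv, hst.zero, hf s'
          ⟨fun x hx => hst.low x hx.le, hst.mem, hsol⟩⟩, fun d hd => by omega⟩).trans ?_
        gcongr
        split_ifs
        · nlinarith [Nat.zero_le ((d + 1) * c)]
        · nlinarith [Nat.zero_le (d * c)]
      · by_cases ht : t ∈ bad
        · rw [if_pos ht]
          rw [hbad, Finset.mem_filter, ← hp.sol] at ht
          refine iInf₂_le (d + 1) ⟨fun h => by omega, fun d' hd' => ?_⟩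
          obtain rfl : d' = d := by omega
          exact ⟨hp.go hv, len, G, hp.discard ht.2, hG, hd, hlen⟩
        · rw [if_neg ht]
          rw [hbad, Finset.mem_filter, ← hp.sol] at ht
          have hle : violations P el (s'.sol 0) ≤ 64 * r :=
            not_lt.1 fun hlt => ht ⟨Finset.mem_univ _, hlt⟩
          have hv' : ∃ x, Violates P (s'.sol 0) (el x) := by
            by_contra! hno
            exact hv (violations_eq_zero_iff.2 hno)
          obtain ⟨x, hx⟩ := hv'
          rw [hp.sol] at hx
          have hsub : G ∪ (Finset.univ.image fun j => el (t j)) ⊆ Finset.univ.image el := by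
            refine Finset.union_subset hG fun y hy => ?_
            obtain ⟨j, -, rfl⟩ := Finset.mem_image.1 hy
            simp
          obtain ⟨b, hbB, hbv⟩ := h.exists_violates_of_basis ⟨el (t ⟨0, hr⟩), by simp⟩ hsub hB0 hB hBa
            (i := el x) (by simp) hx
          have hbG : b ∉ G := fun hb => h.not_violates_of_mem (Finset.mem_union_left _ hb) hbv
          have hbV : b ∈ violators P el (s'.sol 0) := by
            obtain ⟨y, -, rfl⟩ := Finset.mem_image.1 (hB hbB)
            rw [hp.sol]
            exact Finset.mem_image_of_mem _ (Finset.mem_filter.2 ⟨Finset.mem_univ _, hbv⟩)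
          have hlt : (B \ (G ∪ violators P el (s'.sol 0))).card < (B \ G).card := by
            refine Finset.card_lt_card (Finset.ssubset_iff_of_subset ?_ |>.2 ⟨b, ?_, ?_⟩)
            · exact Finset.sdiff_subset_sdiff le_rfl Finset.subset_union_left
            · exact Finset.mem_sdiff.2 ⟨hbB, hbG⟩
            · exact fun hb => (Finset.mem_sdiff.1 hb).2 (Finset.mem_union_right _ hbV)
          -- If `d` were 0, the whole basis would already be kept and there would be no violator.
          obtain ⟨d, rfl⟩ : ∃ e, d = e + 1 := ⟨d - 1, by omega⟩
          refine iInf₂_le (d + 1) ⟨fun h => by omega, fun d' hd' => ?_⟩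
          obtain rfl : d' = d := by omega
          refine ⟨hp.go hv, _, _, hp.keep hle, Finset.union_subset hG ?_, by omega, ?_⟩
          · intro y hy
            obtain ⟨z, -, rfl⟩ := Finset.mem_image.1 hy
            simp
          · rw [mul_add] at hlen
            omega
    -- A good sample, of probability at least one half, lowers the potential by `2 * c`, so the mean
    -- drop is at least `c`, the cost of a round.
    · have havg := average_le (bad := bad) (F := fun t =>
        ((if t ∈ bad then 2 * (d + 1) * c + 1 else 2 * d * c + 1 : ℕ) : ℝ≥0∞) + F) (F₀ := F)
        (α := 2 * d * c + 1) (β := 2 * (d + 1) * c + 1) (γ := 2 * d * c + c + 1) 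
        (fun t ht => by rw [if_pos ht]) (fun t ht => by rw [if_neg ht]) (by
          rw [Fintype.card_fun, Fintype.card_fin, Fintype.card_fin]
          obtain ⟨k, hk⟩ : ∃ k, m ^ r = bad.card + k := ⟨m ^ r - bad.card, by omega⟩
          have hbk : bad.card ≤ k := by omega
          rw [hk, Nat.add_sub_cancel_left]
          have := Nat.mul_le_mul_right c hbk
          nlinarith)
      rw [Fintype.card_fun, Fintype.card_fin, Fintype.card_fin] at havg
      refine (add_le_add_right (add_le_add_right havg _) 1).trans ?_
      rw [← add_assoc, ← add_assoc]
      gcongr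
      rw [← Nat.cast_one, ← Nat.cast_add, ← Nat.cast_add]
      refine Nat.cast_le.2 ?_
      have : 2 * (d + 1) * c = 2 * d * c + 2 * c := by ring
      omega

end

/-! ### The base solver, the nesting and the complete program -/

section

variable {n : ℕ} {P : Fin n → Gamut} {solver ans : Finset (Fin n) → Option (ℝ × Gamut)}

/-- Load the `k` elements of the list that starts at `reg o` into the registers
`o + 2 + i, …, o + 2 + i + k - 1`, and continue with `l`. -/
def loadInto (o : ℕ) : ℕ → ℕ → List Prog → List Prog
  | 0, _, l => l
  | k + 1, i, l => .load (o + 2 + i) o :: .add o o (o + 1) :: loadInto o k (i + 1) l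

theorem loadInto_spec {o : ℕ} {l : List Prog} {c : ℕ} {Q : Store → Prop} (k : ℕ) {i : ℕ} {s : Store}
    (hone : s.reg (o + 1) = 1)
    (h : ∀ s', (∀ x, x < o → s'.reg x = s.reg x) → s'.mem = s.mem →
      (∀ j, j < i → s'.reg (o + 2 + j) = s.reg (o + 2 + j)) →
      (∀ j, j < k → s'.reg (o + 2 + i + j) = s.mem (s.reg o + j)) → Tri P solver s' (seqs l) c Q) :
    Tri P solver s (seqs (loadInto o k i l)) (c + 4 * k) Q := by
  induction k generalizing i s with
  | zero => exact h s (fun _ _ => rfl) rfl (fun _ _ => rfl) (fun j hj => absurd hj (by omega))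
  | succ k ih =>
    refine Tri.mono (Tri.load <| Tri.add <| ih (i := i + 1) ?_ ?_) (by omega)
    · have : o + 1 ≠ o + 2 + i := by omega
      simp [Store.setReg, this, hone]
    · intro s' h1 h2 h3 h4
      have hne : o + 1 ≠ o + 2 + i := by omega
      have hne' : o ≠ o + 2 + i := by omega
      refine h s' (fun x hx => ?_) h2 (fun j hj => ?_) (fun j hj => ?_)
      · rw [h1 x hx]
        have : x ≠ o := by omega
        have : x ≠ o + 2 + i := by omega
        simp [Store.setReg, *]
      · rw [h3 j (by omega)]
        have : o + 2 + j ≠ o := by omega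
        have : j ≠ i := by omega
        simp [Store.setReg, *]
      · rcases j with _ | j
        · rw [add_zero, h3 i (by omega)]
          have : o + 2 + i ≠ o := by omega
          simp [Store.setReg, *]
        · have := h4 j (by omega)
          rw [show o + 2 + i + (j + 1) = o + 2 + (i + 1) + j by omega, this]
          simp only [Store.setReg, Function.update_self, Function.update_of_ne hne,
            Function.update_of_ne hne', hone]
          congr 1
          omega

/-- Solve a problem of 26 projectors by the primitive. -/
def solveDirectly (o : ℕ) : Prog :=
  seqs (.const (o + 1) 1 :: loadInto o 26 0 [.solve 0 ((List.range 26).map fun j => o + 2 + j)])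

theorem solveDirectly_spec (h : LPOracle P solver ans) (o : ℕ) :
    Solves P solver ans (solveDirectly o) o 26 120 := by
  classical
  intro s S hb hS
  have hS' := hS
  obtain ⟨e, he, rfl⟩ := hS.exists_fun
  refine Tri.mono (Tri.const <| loadInto_spec (c := 3) 26 ?_ ?_) (by norm_num)
  · simp [Store.setReg]
  intro s' h1 h2 _ h4
  refine Tri.solve <| Tri.nil ⟨fun x hx => ?_, fun y _ => ?_, ?_⟩
  · have : x ≠ o + 1 := by omega
    simp [Store.setSol, h1 x hx, Store.setReg, this]
  · simp [Store.setSol, h2, Store.setReg]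
  · have hset : ({i : Fin n | (i : ℕ) ∈ ((List.range 26).map fun j => o + 2 + j).map s'.reg} :
        Finset (Fin n)) = Finset.univ.image e := by
      ext i
      have h5 : ∀ j, j < 26 → s'.reg (o + 2 + j) = s.mem (s.reg o + j) := fun j hj => by
        have := h4 j hj
        simpa [Store.setReg] using this
      have h6 := hS' i
      simp only [Fin.val_inj, exists_eq_right] at h6
      rw [Finset.mem_filter_univ, ← h6]
      simp only [List.map_map, List.mem_map, List.mem_range, Function.comp_apply]
      constructor
      · rintro ⟨j, hj, hji⟩
        exact ⟨s.reg o + j, by omega, by omega, by rw [← h5 j hj, hji]⟩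
      · rintro ⟨x, hx1, hx2, hx3⟩
        refine ⟨x - s.reg o, by omega, ?_⟩
        rw [h5 _ (by omega), ← hx3]
        congr 1
        omega
    simp only [Store.setSol, Function.update_self]
    rw [hset]
    exact h.solver_eq _ ⟨e 0, by simp⟩ (Finset.card_image_le.trans (by simp))

/-- Solve a problem by sampling until a sample of size 26 contains a basis. -/
def rejectSolver (o : ℕ) : Prog :=
  seqs [.const (o + 2) 1, .const (o + 13) 0, .sub (o + 5) (o + 1) o, .sub (o + 5) (o + 5) (o + 2),
    .const (o + 3) 26, .const (o + 4) 0, .add (o + 6) (o + 1) (o + 13), .const (o + 12) 1,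
    mainLoop o (solveDirectly (o + 16))]

/-- The loop costs `O(L ^ 27)`. The exponent is rounded up to a power of two so that repeated
halving reaches 1. -/
theorem rejectSolver_spec (h : LPOracle P solver ans) (o : ℕ) {L : ℕ} (hL : 1 ≤ L) :
    Solves P solver ans (rejectSolver o) o L (1000 * L ^ 32) := by
  classical
  intro s S hb hS
  obtain ⟨e, he, rfl⟩ := hS.exists_fun
  refine Tri.mono (Tri.const <| Tri.const <| Tri.sub <| Tri.sub <| Tri.const <| Tri.const <|
    Tri.add <| Tri.const <| Tri.cons (mainLoop_reject h (s₀ := s) he ?_ ?_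
      (solveDirectly_spec h (o + 16))) fun s' hs' => Tri.nil hs') ?_
  · refine ⟨fun x hx => ?_, ?_, ?_, ?_, ?_, ?_, ?_, ?_, fun y _ => ?_, ?_⟩
    · have h2 : ∀ j, 0 < j → x ≠ o + j := fun j hj => by omega
      simp [Store.setReg, h2]
    · simp [Store.setReg, hb]
    · simp [Store.setReg]
    · simp [Store.setReg]
    · simp [Store.setReg]
    · simp [Store.setReg, hb]
      omega
    · simp [Store.setReg]
    · simp [Store.setReg, hb]
    · simp [Store.setReg]
    · exact Holds.empty _ _
  · simp [Store.setReg]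
  · have h1 : L ^ 26 * L ≤ L ^ 32 := by
      rw [← pow_succ]
      exact Nat.pow_le_pow_right hL (by norm_num)
    have h2 : L ^ 26 ≤ L ^ 32 := Nat.pow_le_pow_right hL (by norm_num)
    have h3 : 1 ≤ L ^ 32 := Nat.one_le_pow _ _ hL
    have h4 : L ^ 26 * (14 * 26 + 120 + 13 * L + 42) = 526 * L ^ 26 + 13 * (L ^ 26 * L) := by ring
    rw [h4]
    omega

/-- Compute the least number in `reg (o + 3)` whose square is at least `reg (o + 5)`. -/
def sqrtLoop (o : ℕ) : Prog :=
  -- The machine cannot multiply; the square in `reg (o + 14)` is updated by `(r + 1)² = r² + r + r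
  -- + 1`.
  .whileLt (o + 14) (o + 5) (seqs [.add (o + 14) (o + 14) (o + 3), .add (o + 14) (o + 14) (o + 3),
    .add (o + 14) (o + 14) (o + 2), .add (o + 3) (o + 3) (o + 2)])

theorem sqrtLoop_spec {o : ℕ} {s : Store} (hone : s.reg (o + 2) = 1) (hr : s.reg (o + 3) = 0)
    (hsq : s.reg (o + 14) = 0) (hm : 1 ≤ s.reg (o + 5)) :
    Tri P solver s (sqrtLoop o) (10 * ((s.reg (o + 5) - 1).sqrt + 1) + 1) fun s' =>
      (∀ x, x ≠ o + 3 → x ≠ o + 14 → s'.reg x = s.reg x) ∧ s'.mem = s.mem ∧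
      s'.reg (o + 3) = (s.reg (o + 5) - 1).sqrt + 1 := by
  set N := (s.reg (o + 5) - 1).sqrt + 1 with hN
  have h1 : ∀ r, r < N → r * r < s.reg (o + 5) := fun r hr => by
    have := Nat.le_sqrt.1 (Nat.lt_succ_iff.1 hr)
    omega
  have h2 : s.reg (o + 5) ≤ N * N := by
    have := Nat.lt_succ_sqrt (s.reg (o + 5) - 1)
    simp only [Nat.succ_eq_add_one, ← hN] at this
    omega
  refine Tri.mono (Tri.whileLt (c := 9) (fun k s' =>
    (∀ x, x ≠ o + 3 → x ≠ o + 14 → s'.reg x = s.reg x) ∧ s'.mem = s.mem ∧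
      s'.reg (o + 3) + k = N ∧ s'.reg (o + 14) = s'.reg (o + 3) * s'.reg (o + 3)) ?_ ?_ N
      ⟨fun _ _ _ => rfl, rfl, by omega, by rw [hr, hsq]⟩) (by omega)
  · rintro k s' ⟨a1, a2, a3, a4⟩
    have e5 : s'.reg (o + 5) = s.reg (o + 5) := a1 _ (by omega) (by omega)
    have e2 : s'.reg (o + 2) = 1 := (a1 _ (by omega) (by omega)).trans hone
    refine ⟨by rw [e5, a4]; exact h1 _ (by omega), ?_⟩
    refine Tri.mono (Tri.add <| Tri.add <| Tri.add <| Tri.add <| Tri.nil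
      ⟨fun x b1 b2 => ?_, ?_, ?_, ?_⟩) (by norm_num)
    · simp [Store.setReg, b1, b2, a1]
    · simp [Store.setReg, a2]
    · simp [Store.setReg, e2]
      omega
    · simp [Store.setReg, e2, a4]
      ring
  · rintro s' ⟨a1, a2, a3, a4⟩
    have e5 : s'.reg (o + 5) = s.reg (o + 5) := a1 _ (by omega) (by omega)
    have e3 : s'.reg (o + 3) = N := by omega
    refine ⟨by rw [e5, a4, e3]; omega, a1, a2, e3⟩

/-- Clarkson's algorithm, which calls `callee` for problems of size about `√m`. -/
def clarkson (o : ℕ) (callee : Prog) : Prog :=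
  seqs [.const (o + 2) 1, .const (o + 13) 0, .const (o + 3) 0, .const (o + 14) 0,
    -- Six doublings turn `r` into the threshold `64 * r`.
    .sub (o + 5) (o + 1) o, sqrtLoop o, .sub (o + 5) (o + 5) (o + 2), .add (o + 4) (o + 3) (o + 3),
    .add (o + 4) (o + 4) (o + 4), .add (o + 4) (o + 4) (o + 4), .add (o + 4) (o + 4) (o + 4),
    .add (o + 4) (o + 4) (o + 4), .add (o + 4) (o + 4) (o + 4), .add (o + 6) (o + 1) (o + 13),
    .const (o + 12) 1, mainLoop o callee]

/-- The exponent is halved because the subproblems have size at most `1665 * r` with `r * r ≤ 4 *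
m`. The linear work of a round is absorbed by `m ^ e`, which needs `1 ≤ e`. -/
theorem clarkson_spec (h : LPOracle P solver ans) (o : ℕ) {callee : Prog} {C e : ℕ} (he : 1 ≤ e)
    (hcal : ∀ L, 1 ≤ L → Solves P solver ans callee (o + 16) L (C * L ^ (2 * e))) {m : ℕ}
    (hm : 1 ≤ m) :
    Solves P solver ans (clarkson o callee) o m
      ((54 * (C * 1665 ^ (2 * e) * 4 ^ e + 111) + 100) * m ^ e) := by
  classical
  intro s S hb hS
  obtain ⟨el, hel, rfl⟩ := hS.exists_fun
  set r := (m - 1).sqrt + 1 with hr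
  have hr1 : 1 ≤ r := by omega
  have hmr : m ≤ r * r := by
    have := Nat.lt_succ_sqrt (m - 1)
    simp only [Nat.succ_eq_add_one, ← hr] at this
    omega
  have hrm : r * r ≤ 4 * m := by
    have h1 := Nat.sqrt_le (m - 1)
    rcases Nat.eq_zero_or_pos (m - 1).sqrt with h0 | h0
    · rw [hr, h0]
      omega
    · have h2 : r * r ≤ (2 * (m - 1).sqrt) * (2 * (m - 1).sqrt) :=
        Nat.mul_le_mul (by omega) (by omega)
      nlinarith [Nat.sub_le m 1]
  have hme : m ≤ m ^ e := Nat.le_self_pow (by omega) m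
  have hm1 : 1 ≤ m ^ e := Nat.one_le_pow _ _ hm
  have hr4 : r ≤ 4 * m ^ e := by nlinarith
  have hpow : r ^ (2 * e) ≤ 4 ^ e * m ^ e := by
    rw [pow_mul, ← mul_pow, pow_two]
    exact Nat.pow_le_pow_left hrm e
  have hcost : C * (1665 * r) ^ (2 * e) ≤ C * 1665 ^ (2 * e) * 4 ^ e * m ^ e := by
    rw [mul_pow, ← mul_assoc, mul_assoc (C * _) (4 ^ e)]
    exact Nat.mul_le_mul_left _ hpow
  refine Tri.mono (Tri.const <| Tri.const <| Tri.const <| Tri.const <| Tri.sub <|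
    Tri.cons (Tri.conseq (sqrtLoop_spec ?_ ?_ ?_ ?_) le_rfl fun s' hs' => hs')
    (c' := 54 * (14 * r + C * (1665 * r) ^ (2 * e) + 13 * m + 42) + 30) fun s₁ hs₁ => ?_) ?_
  · simp [Store.setReg]
  · simp [Store.setReg]
  · simp [Store.setReg]
  · simpa [Store.setReg, hb] using hm
  · obtain ⟨k1, k2, k3⟩ := hs₁
    have e5 : s₁.reg (o + 5) = m := by
      rw [k1 _ (by omega) (by omega)]
      simp [Store.setReg, hb]
    have e3 : s₁.reg (o + 3) = r := by
      rw [k3]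
      simp [Store.setReg, hb, hr]
    have e2 : s₁.reg (o + 2) = 1 := by
      rw [k1 _ (by omega) (by omega)]
      simp [Store.setReg]
    have e13 : s₁.reg (o + 13) = 0 := by
      rw [k1 _ (by omega) (by omega)]
      simp [Store.setReg]
    have e1 : s₁.reg (o + 1) = s.reg o + m := by
      rw [k1 _ (by omega) (by omega)]
      simp [Store.setReg, hb]
    have elow : ∀ x, x ≤ o → s₁.reg x = s.reg x := fun x hx => by
      have h2 : ∀ j, 0 < j → x ≠ o + j := fun j hj => by omega
      rw [k1 _ (by omega) (by omega)]
      simp [Store.setReg, h2]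
    have emem : s₁.mem = s.mem := k2
    refine Tri.mono (Tri.sub <| Tri.add <| Tri.add <| Tri.add <| Tri.add <| Tri.add <| Tri.add <|
      Tri.add <| Tri.const <| Tri.cons (mainLoop_clarkson h (s₀ := s) hel hr1 hmr
        (K := C * (1665 * r) ^ (2 * e)) ?_ ?_ fun L hL1 hL2 => ?_) fun s' hs' => Tri.nil hs')
        (by omega)
    · refine ⟨fun x hx => ?_, ?_, ?_, ?_, ?_, ?_, ?_, ?_, fun y _ => ?_, ?_⟩
      · have h2 : ∀ j, 0 < j → x ≠ o + j := fun j hj => by omega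
        simp [Store.setReg, h2, elow x hx]
      · simp [Store.setReg, e1]
      · simp [Store.setReg, e2]
      · simp [Store.setReg, e3]
      · simp [Store.setReg, e3]
        ring
      · simp [Store.setReg, e2, e5]
        omega
      · simp [Store.setReg, e13]
      · simp [Store.setReg, e1, e13]
      · simp [Store.setReg, emem]
      · exact Holds.empty _ _
    · simp [Store.setReg]
    · intro s' S' a1 a2
      refine (hcal L hL1 s' S' a1 a2).mono ?_
      gcongr
  · have e5 : s.reg (o + 1) - s.reg o - 1 = m - 1 := by omega
    simp only [Store.setReg, Function.update_self]
    simp [e5, ← hr]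
    have : (54 * (C * 1665 ^ (2 * e) * 4 ^ e + 111) + 100) * m ^ e =
      54 * (C * 1665 ^ (2 * e) * 4 ^ e * m ^ e) + 54 * 111 * m ^ e + 100 * m ^ e := by ring
    omega

/-- The nested solvers. -/
def nestedSolver : ℕ → ℕ → Prog
  | 0, o => rejectSolver o
  | i + 1, o => clarkson o (nestedSolver i (o + 16))

/-- The exponent `2 ^ (5 - i)` starts at 32 and reaches 1 at `i = 5`. The constant is chosen before
`n` and the projectors. -/
theorem exists_nestedSolver_cost (i : ℕ) (hi : i ≤ 5) (o : ℕ) :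
    ∃ C : ℕ, ∀ {n : ℕ} {P : Fin n → Gamut} {solver ans : Finset (Fin n) → Option (ℝ × Gamut)},
      LPOracle P solver ans → ∀ L, 1 ≤ L →
        Solves P solver ans (nestedSolver i o) o L (C * L ^ 2 ^ (5 - i)) := by
  induction i generalizing o with
  | zero => exact ⟨1000, fun h L hL => rejectSolver_spec h o hL⟩
  | succ i ih =>
    obtain ⟨C, hC⟩ := ih (by omega) (o + 16)
    refine ⟨_, fun h L hL => clarkson_spec h o (C := C) (e := 2 ^ (5 - (i + 1))) Nat.one_le_two_pow
      (fun L hL => ?_) hL⟩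
    have := hC h L hL
    rwa [show 5 - i = 5 - (i + 1) + 1 by omega, pow_succ'] at this

/-- List all projectors in memory, and solve. -/
def gamutSolver : Prog :=
  seqs [.const 1 0, .const 2 1, .const 3 0, .whileLt 1 0 (seqs [.store 1 1, .add 1 1 2]),
    .const 10 0, .add 11 0 3, nestedSolver 5 10]

theorem exists_gamutSolver_cost :
    ∃ C : ℕ, ∀ {n : ℕ} {P : Fin n → Gamut} {solver ans : Finset (Fin n) → Option (ℝ × Gamut)},
      LPOracle P solver ans → 1 ≤ n →
        Tri P solver (initial gamutSolver n).2 gamutSolver (C * n)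
          fun s' => s'.sol 0 = ans Finset.univ := by
  obtain ⟨C, hC⟩ := exists_nestedSolver_cost 5 le_rfl 10
  refine ⟨C + 50, fun {n P solver ans} h hn => ?_⟩
  refine Tri.mono (Tri.const <| Tri.const <| Tri.const <|
    Tri.cons (c := 6 * n + 1) (Q := fun s' => s'.reg 0 = n ∧ s'.reg 3 = 0 ∧
      ∀ y, y < n → s'.mem y = y) ?_ fun s₁ hs₁ => Tri.const <| Tri.add <|
    Tri.cons (Tri.conseq (hC h n hn _ Finset.univ ?_ ?_) le_rfl fun s' hs' => hs'.2.2)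
      fun s' hs' => Tri.nil hs') ?_
  · refine Tri.mono (Tri.whileLt (c := 5) (fun k s' => s'.reg 0 = n ∧ s'.reg 2 = 1 ∧ s'.reg 3 = 0 ∧
      s'.reg 1 + k = n ∧ ∀ y, y < s'.reg 1 → s'.mem y = y) ?_ ?_ n ?_) (by omega)
    · rintro k s' ⟨a1, a2, a3, a4, a5⟩
      refine ⟨by omega, Tri.mono (Tri.store <| Tri.add <| Tri.nil ⟨?_, ?_, ?_, ?_, ?_⟩)
        (by norm_num)⟩
      · simp [Store.setReg, Store.setMem, a1]
      · simp [Store.setReg, Store.setMem, a2]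
      · simp [Store.setReg, Store.setMem, a3]
      · simp [Store.setReg, Store.setMem, a2]
        omega
      · intro y hy
        simp [Store.setReg, Store.setMem, a2] at hy ⊢
        rcases eq_or_ne y (s'.reg 1) with rfl | hne
        · simp
        · rw [Function.update_of_ne hne]
          exact a5 y (by omega)
    · rintro s' ⟨a1, a2, a3, a4, a5⟩
      exact ⟨by omega, a1, a3, fun y hy => a5 y (by omega)⟩
    · simp [Store.setReg, initial]
  · obtain ⟨a1, a2, a3⟩ := hs₁
    simp [Store.setReg, a1, a2]
  · obtain ⟨a1, a2, a3⟩ := hs₁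
    intro i
    simp only [Store.setReg]
    constructor
    · rintro ⟨x, b1, b2, b3⟩
      simp at b1 b2
      exact ⟨⟨x, b2⟩, Finset.mem_univ _, by rw [← b3, a3 x b2]⟩
    · rintro ⟨j, -, rfl⟩
      exact ⟨j, by simp, by simp, a3 j j.2⟩
  · simp only [Nat.sub_self, pow_zero, pow_one]
    nlinarith

end

theorem theorem2 :
    ∃ (prog : Prog) (k C : ℕ),
      ∀ (q : Corner → Color → ℝ) (hq : ∀ c, QuasiconvexOn ℝ Set.univ (q c))
        (n : ℕ) (_hn : 0 < n) (P : Fin n → Gamut)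
        (solver : Finset (Fin n) → Option (ℝ × Gamut))
        (_hsolver : ∀ S : Finset (Fin n), S.Nonempty → S.card ≤ k →
          IsAnswer (gamutProgram q hq P S) (solver S)),
        expectedTime P solver prog ≤ (C : ENNReal) * (n : ENNReal) ∧
        ∀ (m : ℕ) (s : Store), ([], s) ∈ (configAfter P solver prog m).support →
          IsAnswer (gamutProgram q hq P Finset.univ) (s.sol 0) ∧
          (∀ (t : ℝ) (Γ : Gamut), s.sol 0 = some (t, Γ) →
            (∀ i, Γ.colors ⊆ (P i).colors) ∧ t = gamutQuality q Γ ∧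
            ∀ Γ' : Gamut, (∀ i, Γ'.colors ⊆ (P i).colors) →
              gamutQuality q Γ ≤ gamutQuality q Γ') ∧
          (s.sol 0 = none → ¬ ∃ Γ : Gamut, ∀ i, Γ.colors ⊆ (P i).colors) := by
  classical
  obtain ⟨C, hC⟩ := exists_gamutSolver_cost
  refine ⟨gamutSolver, 26, C, fun q hq n hn P solver hsolver => ?_⟩
  obtain ⟨ans, hLP, hans⟩ := exists_lpOracle hq hsolver
  have huniv : (Finset.univ : Finset (Fin n)).Nonempty := ⟨⟨0, hn⟩, Finset.mem_univ _⟩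
  -- A wrong final store costs `∞`, so a finite bound excludes it from the support.
  let f : Store → ℝ≥0∞ := fun s => if s.sol 0 = ans Finset.univ then 0 else ∞
  have hwp : wp P solver gamutSolver f (initial gamutSolver n).2 ≤ (C : ℝ≥0∞) * n := by
    have := hC hLP hn f 0 fun s' hs' => by simp [f, hs']
    simpa using this
  refine ⟨(expectedTime_le_wp f gamutSolver).trans hwp, fun m s hs => ?_⟩
  have hne : wp P solver gamutSolver f (initial gamutSolver n).2 ≠ ∞ :=
    ne_top_of_le_ne_top (ENNReal.mul_ne_top (by simp) (by simp)) hwp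
  have hsol : s.sol 0 = ans Finset.univ := by
    by_contra hno
    exact ne_top_of_wp_ne_top hne hs (by simp [f, hno])
  have hA := hans Finset.univ huniv
  rw [← hsol] at hA
  exact ⟨hA, hA.gamut_spec hq⟩
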